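/- **Definitions.** Fix a field $\Bbbk$. A *signed permutation* of size $n \in \mathbb{N}$ is a permutation $\tau$ of $[n] = \{1, \dots, n\}$, written as the word $\tau(1) \cdots \tau(n)$, together with a sign in $\{+,-\}$ for every value in $[n]$. Let $\mathrm{FQSym}_\pm$ be the algebra over $\Bbbk$ with basis $(F_\tau)$ indexed by all signed permutations, and with product $F_\tau \cdot F_{\tau'} = \sum_\sigma F_\sigma$, where $\sigma$ runs over the shuffles of the word of $\tau$ with the word of $\tau'$ shifted by the size of $\tau$ (signs travel with their values). A *Cambrian tree* on $[n]$ is a directed tree with node set $[n]$ together with a sign $\varepsilon_v$ for each node $v$, in which a negative node has one parent and two children (its left and right descendant subtrees), a positive node has one child and two parents (its left and right ancestor subtrees), subtrees are allowed to be empty (an empty subtree is a *leaf*, incoming if it replaces a child and outgoing if it replaces a parent), and all nodes in the left (resp. right) subtree of $v$ are smaller (resp. larger) than $v$. The unique tree with $n = 0$ is included. Leaves are ordered from left to right as in the planar drawing of the tree: of two outgoing (resp. incoming) leaves, the left one is the one lying in the left subtree of the positive (resp. negative) node whose two ancestor (resp. descendant) subtrees separate them. For an arc $i \to j$ with $i <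 j$ of a Cambrian tree $T$, let $L$ be the left subtree of $i$, $B$ the remaining incoming subtree of $i$, $R$ the right subtree of $j$ and $A$ the remaining outgoing subtree of $j$. The *increasing rotation* of $i \to j$ reverses this arc to $j \to i$ and attaches $L$ and $A$ to $i$ and $B$ and $R$ to $j$, keeping all signs. For Cambrian trees on $[n]$ write $T \le T'$ if $T'$ is obtained from $T$ by a finite (possibly empty) sequence of increasing rotations. For a Cambrian tree $T$ let $P_T = \sum_\tau F_\tau$, where $\tau$ runs over the linear extensions of $T$, that is, the permutations of its nodes, with the signs of $T$, in which $u$ appears before $v$ for every arc $u \to v$ of $T$. The *Cambrian algebra* $\mathrm{Camb}$ is the linear span in $\mathrm{FQSym}_\pm$ of the elements $P_T$ for all Cambrian trees $T$. Set $$E^T = \sum_{T \le T'} P_{T'} \qquad\text{and}\qquad H^T = \sum_{T' \le T} P_{T'}.$$ For Cambrian trees $T$ on $[n]$ and $T'$ on $[n']$, let $T \nearrow \bar T'$ (resp. $T \nwarrow \bar T'$) be the signed tree on $[n+n']$ obtained by shifting all labels of $T'$ by $n$ and grafting the rightmost outgoing leaf of $T$ on the leftmost incoming leaf of $T'$ (resp.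 the rightmost incoming leaf of $T$ on the leftmost outgoing leaf of $T'$); if one of the two trees is empty, the result is the other one. **Proposition.** The families $(E^T)$ and $(H^T)$, where $T$ runs over all Cambrian trees, are multiplicative linear bases of $\mathrm{Camb}$. Explicitly, for all Cambrian trees $T$ and $T'$, the trees $T \nearrow \bar T'$ and $T \nwarrow \bar T'$ are Cambrian trees, and $$E^T \cdot E^{T'} = E^{T \nearrow \bar T'} \qquad\text{and}\qquad H^T \cdot H^{T'} = H^{T \nwarrow \bar T'}.$$ -/

import Mathlib

namespace Cambrian

/-- A directed graph on the vertices `Fin n`, identified with their labels, each vertex carrying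
a sign (`true` is `+`, `false` is `-`). `arc u v` means that there is an arc `u → v`; then `u` is
a child of `v` and `v` is a parent of `u`. Only the labelled nodes are recorded: an empty subtree
of a node (a leaf of the tree) is a missing arc, and the signs tell which slots a node has. -/
@[ext]
structure SignedDigraph (n : ℕ) where
  sign : Fin n → Bool
  arc : Fin n → Fin n → Prop

namespace SignedDigraph

variable {n m : ℕ}

/-- The underlying undirected graph. -/
def graph (T : SignedDigraph n) : SimpleGraph (Fin n) := SimpleGraph.fromRel T.arc

/-- `T.Branch v w u`: the vertex `u` belongs to the connected component of `w` in `T` with `v`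
removed. When `T` is a tree and `w` is a neighbour of `v`, this is the subtree of `v` that is
attached to `v` by the edge between `v` and `w`. -/
def Branch (T : SignedDigraph n) (v w u : Fin n) : Prop :=
  ∃ p : T.graph.Walk w u, v ∉ p.support

/-- Cambrian trees with vertex labels `Fin n`. A negative node has one parent slot, a left child
slot and a right child slot; a positive node has one child slot, a left parent slot and a right
parent slot; every slot holds a (possibly empty) subtree. -/
structure IsCambrian (T : SignedDigraph n) : Prop where
  asymm : ∀ u v, T.arc u v → ¬ T.arc v u
  acyclic : T.graph.IsAcyclic
  connected : T.graph.Preconnected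
  neg_parent : ∀ v, T.sign v = false → ∀ w w', T.arc v w → T.arc v w' → w = w'
  neg_children : ∀ v, T.sign v = false →
    ∀ w w', T.arc w v → T.arc w' v → (w < v ↔ w' < v) → w = w'
  neg_left : ∀ v, T.sign v = false → ∀ w, T.arc w v → w < v → ∀ u, T.Branch v w u → u < v
  neg_right : ∀ v, T.sign v = false → ∀ w, T.arc w v → v < w → ∀ u, T.Branch v w u → v < u
  pos_child : ∀ v, T.sign v = true → ∀ w w', T.arc w v → T.arc w' v → w = w'
  pos_parents : ∀ v, T.sign v = true →
    ∀ w w', T.arc v w → T.arc v w' → (w < v ↔ w' < v) → w = w'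
  pos_left : ∀ v, T.sign v = true → ∀ w, T.arc v w → w < v → ∀ u, T.Branch v w u → u < v
  pos_right : ∀ v, T.sign v = true → ∀ w, T.arc v w → v < w → ∀ u, T.Branch v w u → v < u

/-- `S` is obtained from `T` by rotating the arc `i → j`. Write `L` for the left subtree of `i`,
`B` for the remaining incoming subtree of `i`, `R` for the right subtree of `j` and `A` for the
remaining outgoing subtree of `j`. The arc `i → j` is reversed, `B` moves from `i` to `j`, `A`
moves from `j` to `i`, and all other arcs stay. -/
def RotatesAt (T S : SignedDigraph n) (i j : Fin n) : Prop :=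
  let toB : Fin n → Prop := fun b => T.arc b i ∧ (T.sign i = false → i < b)
  let toA : Fin n → Prop := fun a => T.arc j a ∧ (T.sign j = true → a < j)
  T.arc i j ∧ S.sign = T.sign ∧
    ∀ u v, S.arc u v ↔
      (u = j ∧ v = i) ∨ (toB u ∧ v = j) ∨ (u = i ∧ toA v) ∨
        (T.arc u v ∧ ¬ (u = i ∧ v = j) ∧ ¬ (toB u ∧ v = i) ∧ ¬ (u = j ∧ toA v))

/-- For a positive node `p`: the left ancestor subtree of `p` contains `u`. -/
def InLeftAncestors (T : SignedDigraph n) (p u : Fin n) : Prop :=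
  ∃ w, T.arc p w ∧ w < p ∧ T.Branch p w u

/-- For a positive node `p`: the right ancestor subtree of `p` contains `u`. -/
def InRightAncestors (T : SignedDigraph n) (p u : Fin n) : Prop :=
  ∃ w, T.arc p w ∧ p < w ∧ T.Branch p w u

/-- For a negative node `p`: the left descendant subtree of `p` contains `u`. -/
def InLeftDescendants (T : SignedDigraph n) (p u : Fin n) : Prop :=
  ∃ w, T.arc w p ∧ w < p ∧ T.Branch p w u

/-- For a negative node `p`: the right descendant subtree of `p` contains `u`. -/
def InRightDescendants (T : SignedDigraph n) (p u : Fin n) : Prop :=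
  ∃ w, T.arc w p ∧ p < w ∧ T.Branch p w u

/-- The rightmost outgoing leaf of `T` is attached to `v`: the parent slot of `v` (its right
parent slot if `v` is positive) is empty, and this leaf is on the right of every other outgoing
leaf, that is, it does not lie in the left ancestor subtree of a positive node. -/
def RightmostOutLeafAt (T : SignedDigraph n) (v : Fin n) : Prop :=
  (∀ w, T.arc v w → T.sign v = true ∧ w < v) ∧
    ∀ p, T.sign p = true → ¬ T.InLeftAncestors p v

/-- The leftmost outgoing leaf of `T` is attached to `v`. -/
def LeftmostOutLeafAt (T : SignedDigraph n) (v : Fin n) : Prop :=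
  (∀ w, T.arc v w → T.sign v = true ∧ v < w) ∧
    ∀ p, T.sign p = true → ¬ T.InRightAncestors p v

/-- The rightmost incoming leaf of `T` is attached to `v`. -/
def RightmostInLeafAt (T : SignedDigraph n) (v : Fin n) : Prop :=
  (∀ w, T.arc w v → T.sign v = false ∧ w < v) ∧
    ∀ p, T.sign p = false → ¬ T.InLeftDescendants p v

/-- The leftmost incoming leaf of `T` is attached to `v`. -/
def LeftmostInLeafAt (T : SignedDigraph n) (v : Fin n) : Prop :=
  (∀ w, T.arc w v → T.sign v = false ∧ v < w) ∧
    ∀ p, T.sign p = false → ¬ T.InRightDescendants p v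

/-- `T ↗ T'`: shift the labels of `T'` by `n` and graft the rightmost outgoing leaf of `T` on the
leftmost incoming leaf of `T'` (if one of the two is empty, the result is the other one). -/
def graftNE (T : SignedDigraph n) (T' : SignedDigraph m) : SignedDigraph (n + m) where
  sign := Fin.append T.sign T'.sign
  arc x y :=
    (∃ u v, x = Fin.castAdd m u ∧ y = Fin.castAdd m v ∧ T.arc u v) ∨
    (∃ u v, x = Fin.natAdd n u ∧ y = Fin.natAdd n v ∧ T'.arc u v) ∨
    (∃ u v, x = Fin.castAdd m u ∧ y = Fin.natAdd n v ∧
      T.RightmostOutLeafAt u ∧ T'.LeftmostInLeafAt v)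

/-- `T ↖ T'`: shift the labels of `T'` by `n` and graft the rightmost incoming leaf of `T` on the
leftmost outgoing leaf of `T'` (if one of the two is empty, the result is the other one). -/
def graftNW (T : SignedDigraph n) (T' : SignedDigraph m) : SignedDigraph (n + m) where
  sign := Fin.append T.sign T'.sign
  arc x y :=
    (∃ u v, x = Fin.castAdd m u ∧ y = Fin.castAdd m v ∧ T.arc u v) ∨
    (∃ u v, x = Fin.natAdd n u ∧ y = Fin.natAdd n v ∧ T'.arc u v) ∨
    (∃ u v, x = Fin.natAdd n v ∧ y = Fin.castAdd m u ∧
      T.RightmostInLeafAt u ∧ T'.LeftmostOutLeafAt v)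

noncomputable instance : Fintype (SignedDigraph n) :=
  Fintype.ofInjective (fun T => (T.sign, T.arc)) fun S T h => by
    have h' := Prod.mk.inj h
    exact SignedDigraph.ext h'.1 h'.2

end SignedDigraph

/-- The Cambrian trees on `n` nodes. -/
def CambTree (n : ℕ) : Type := {T : SignedDigraph n // T.IsCambrian}

/-- The set of all Cambrian trees, the empty tree included. -/
structure AnyCambTree where
  size : ℕ
  tree : CambTree size

open scoped Classical in
noncomputable instance (n : ℕ) : Fintype (CambTree n) :=
  inferInstanceAs (Fintype {T : SignedDigraph n // T.IsCambrian})

/-- Arcs of the increasing rotation graph. -/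
def CambTree.IncreasingRotation {n : ℕ} (T S : CambTree n) : Prop :=
  ∃ i j, i < j ∧ T.1.RotatesAt S.1 i j

/-- The order of the Cambrian lattice: the reflexive and transitive closure of the increasing
rotation graph. Comparable trees have the same signature. -/
def CambTree.Le {n : ℕ} (T S : CambTree n) : Prop :=
  Relation.ReflTransGen CambTree.IncreasingRotation T S

/-- Signed permutations: `perm i` is the value at position `i`, and `sign a` is the sign carried
by the value `a`. -/
structure SignedPerm where
  size : ℕ
  perm : Equiv.Perm (Fin size)
  sign : Fin size → Bool

/-- The shifted concatenation of two permutations. -/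
def shiftedConcat {n m : ℕ} (σ : Equiv.Perm (Fin n)) (τ : Equiv.Perm (Fin m)) :
    Equiv.Perm (Fin (n + m)) :=
  finSumFinEquiv.permCongr (Equiv.Perm.sumCongr σ τ)

open scoped Classical in
/-- The shifted shuffle product `{(σ τ̄) ∘ π⁻¹}`, where `π` is increasing on the first `n` and on
the last `m` positions. -/
noncomputable def shiftedShuffle {n m : ℕ} (σ : Equiv.Perm (Fin n)) (τ : Equiv.Perm (Fin m)) :
    Finset (Equiv.Perm (Fin (n + m))) :=
  (Finset.univ.filter fun π : Equiv.Perm (Fin (n + m)) =>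
    StrictMono (fun i : Fin n => π (Fin.castAdd m i)) ∧
      StrictMono (fun i : Fin m => π (Fin.natAdd n i))).image
    fun π => shiftedConcat σ τ * π⁻¹

section Algebra

variable (𝕜 : Type*) [Field 𝕜]

/-- The underlying vector space of the algebra of signed permutations. -/
def FQSym : Type _ := SignedPerm →₀ 𝕜

noncomputable instance : AddCommGroup (FQSym 𝕜) := inferInstanceAs (AddCommGroup (SignedPerm →₀ 𝕜))

noncomputable instance : Module 𝕜 (FQSym 𝕜) := inferInstanceAs (Module 𝕜 (SignedPerm →₀ 𝕜))

/-- The basis indexed by the signed permutations. -/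
noncomputable def FQSym.basis : Module.Basis SignedPerm 𝕜 (FQSym 𝕜) :=
  Module.Basis.ofRepr (LinearEquiv.refl 𝕜 (SignedPerm →₀ 𝕜))

/-- The basis vector indexed by a signed permutation. -/
noncomputable def F (σ : SignedPerm) : FQSym 𝕜 := FQSym.basis 𝕜 σ

/-- The product of two basis vectors: the sum over the signed shifted shuffle product, where
signs travel with their values. -/
noncomputable def shuffleSum (σ τ : SignedPerm) : FQSym 𝕜 :=
  ∑ ρ ∈ shiftedShuffle σ.perm τ.perm, F 𝕜 ⟨σ.size + τ.size, ρ, Fin.append σ.sign τ.sign⟩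

/-- The product as a bilinear map. -/
noncomputable def FQSym.mulMap : FQSym 𝕜 →ₗ[𝕜] FQSym 𝕜 →ₗ[𝕜] FQSym 𝕜 :=
  (FQSym.basis 𝕜).constr 𝕜 fun σ => (FQSym.basis 𝕜).constr 𝕜 fun τ => shuffleSum 𝕜 σ τ

noncomputable instance : Mul (FQSym 𝕜) := ⟨fun x y => FQSym.mulMap 𝕜 x y⟩

theorem F_mul_F (σ τ : SignedPerm) : F 𝕜 σ * F 𝕜 τ = shuffleSum 𝕜 σ τ := by
  change FQSym.mulMap 𝕜 (FQSym.basis 𝕜 σ) (FQSym.basis 𝕜 τ) = _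
  rw [FQSym.mulMap, Module.Basis.constr_basis, Module.Basis.constr_basis]

/-- The permutations which, signed by the signature of `T`, are linear extensions of `T`: the
source of every arc appears before its target. -/
def CambTree.IsLinearExtension {n : ℕ} (T : CambTree n) (σ : Equiv.Perm (Fin n)) : Prop :=
  ∀ u v, T.1.arc u v → σ.symm u < σ.symm v

open scoped Classical in
/-- `P_T`, the sum of the linear extensions of `T`. -/
noncomputable def P {n : ℕ} (T : CambTree n) : FQSym 𝕜 :=
  ∑ σ : Equiv.Perm (Fin n) with T.IsLinearExtension σ, F 𝕜 ⟨n, σ, T.1.sign⟩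

/-- The Cambrian algebra, as a subspace of the algebra of signed permutations. -/
noncomputable def Camb : Submodule 𝕜 (FQSym 𝕜) :=
  Submodule.span 𝕜 (Set.range fun T : AnyCambTree => P 𝕜 T.tree)

open scoped Classical in
/-- `E^T`, the sum of `P_S` over `T ≤ S`. -/
noncomputable def E {n : ℕ} (T : CambTree n) : FQSym 𝕜 :=
  ∑ S : CambTree n with T.Le S, P 𝕜 S

open scoped Classical in
/-- `H^T`, the sum of `P_S` over `S ≤ T`. -/
noncomputable def H {n : ℕ} (T : CambTree n) : FQSym 𝕜 :=
  ∑ S : CambTree n with S.Le T, P 𝕜 S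

end Algebra

end Cambrian

/-! The product formulas come from an explicit expansion in the basis `F`. Call a directed path of
`T` from `x` to `y` with `y < x` a decreasing relation. Then `E^T` is the sum of all `F_σ`, with the
signs of `T`, such that `σ` puts `x` before `y` for every decreasing relation (`E_eq`). Grafting `T`
below the shifted `T'` only creates relations from small to large labels, so the decreasing
relations of the graft are those of the two trees (`forall_desc_graftNE`). A word lies in exactly
one shifted shuffle, found from the relative orders of its small and of its large values; hence both
sides of the formula for `E` sum over the same words. The formula for `H` follows by the duality
`op`, which reverses the rotation order.

The expansion needs two facts. First, a permutation with given signs is a linear extension of at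
most one tree (`IsLinearExtension.unique`): an arc of one tree must be a relation of the other
(`below_of_arc`), since a peak or valley on the path there would have its label between the ends of
the arc and contradict the common order of positions. Second, if `σ` respects the decreasing
relations of `T`, it is a linear extension of some larger tree (`exists_le_isLinearExtension`): any
arc that `σ` violates is increasing, and rotating it keeps `σ` compatible (`lt_of_desc_rotate`)
while adding decreasing relations. Conversely, rotations never destroy decreasing relations
(`desc_rotate`).

For the bases, the coefficient at one chosen linear extension of each tree gives a family dual to
the `P_T`, and the number of decreasing relations grows strictly along the order, so `E` and `H` are
unitriangular over `P`.

The tree axioms are handled through `IsColoring`: its conditions, apart from connectedness, concern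
single arcs and vertices instead of walks, so a rotated or grafted tree is proved Cambrian by
exhibiting its colouring. -/

namespace Cambrian

/-! ### Subtrees encoded as colourings -/

namespace SignedDigraph

variable {n m : ℕ}

/-- A colouring of a signed digraph records, for all vertices `v` and `u`, whether `u` lies in
the left (`lt`), middle (`eq`) or right (`gt`) subtree of `v`. The middle subtree is the one
without order constraint: ancestors of a negative vertex, descendants of a positive one. -/
structure IsColoring (T : SignedDigraph n) (c : Fin n → Fin n → Ordering) : Prop where
  conn : T.graph.Preconnected
  adj_eq : ∀ v u u', T.arc u u' → u ≠ v → u' ≠ v → c v u = c v u'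
  in_mid : ∀ v w, T.arc w v → (c v w = .eq ↔ T.sign v = true)
  out_mid : ∀ v w, T.arc v w → (c v w = .eq ↔ T.sign v = false)
  inj : ∀ v w w', (T.arc v w ∨ T.arc w v) → (T.arc v w' ∨ T.arc w' v) → c v w = c v w' → w = w'
  lt_of_lt : ∀ v u, c v u = .lt → u < v
  lt_of_gt : ∀ v u, c v u = .gt → v < u

theorem graph_adj (T : SignedDigraph n) {u v : Fin n} :
    T.graph.Adj u v ↔ u ≠ v ∧ (T.arc u v ∨ T.arc v u) := by
  simp [graph, SimpleGraph.fromRel_adj]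

theorem Branch.refl {T : SignedDigraph n} {v w : Fin n} (h : w ≠ v) : T.Branch v w w :=
  ⟨.nil, by simpa using h.symm⟩

theorem Branch.step {T : SignedDigraph n} {v w u u' : Fin n} (h : T.Branch v w u)
    (ha : T.graph.Adj u u') (hu' : u' ≠ v) : T.Branch v w u' := by
  obtain ⟨p, hp⟩ := h
  exact ⟨p.concat ha, by simp [SimpleGraph.Walk.support_concat, hp, hu'.symm]⟩

/-- Connectedness: every vertex other than `v` lies in a branch at `v`. -/
theorem exists_branch {T : SignedDigraph n} (hT : T.graph.Preconnected) {v u : Fin n}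
    (hu : u ≠ v) : ∃ w, T.graph.Adj v w ∧ T.Branch v w u := by
  obtain ⟨p⟩ := hT u v
  induction p with
  | nil => exact absurd rfl hu
  | @cons a b v h p ih =>
    by_cases hb : b = v
    · subst hb
      exact ⟨a, h.symm, .refl hu⟩
    · obtain ⟨w, hw, hbr⟩ := ih hb
      exact ⟨w, hw, hbr.step h.symm hu⟩

/-- Otherwise there would be two paths from `v` to `w'`: the edge, and the detour through `w`. -/
theorem IsCambrian.branch_inj {T : SignedDigraph n} (hT : T.IsCambrian) {v w w' : Fin n}
    (hw : T.graph.Adj v w) (hw' : T.graph.Adj v w') (h : T.Branch v w w') : w = w' := by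
  classical
  obtain ⟨p, hp⟩ := h
  have hq : v ∉ p.toPath.1.support := fun h => hp (SimpleGraph.Walk.support_bypass_subset_support _ h)
  have := (hT.acyclic.subsingleton_path v w').elim
    ⟨.cons hw p.toPath.1, p.toPath.2.cons hq⟩ (SimpleGraph.Path.singleton hw')
  have h2 := congrArg (fun q : T.graph.Path v w' => q.1.length) this
  simp [SimpleGraph.Path.singleton] at h2
  exact h2.eq

theorem IsCambrian.arc_ne {T : SignedDigraph n} (hT : T.IsCambrian) {u v : Fin n}
    (h : T.arc u v) : u ≠ v := by
  rintro rfl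
  exact hT.asymm _ _ h h

/-- The neighbour `w` of `v` is attached to the slot of `v` without order constraint. -/
def MidNeighbor (T : SignedDigraph n) (v w : Fin n) : Prop :=
  (T.arc w v ∧ T.sign v = true) ∨ (T.arc v w ∧ T.sign v = false)

open scoped Classical in
/-- The colouring of a Cambrian tree by left, middle and right subtrees. -/
noncomputable def color (T : SignedDigraph n) (v u : Fin n) : Ordering :=
  if u = v ∨ ∃ w, T.MidNeighbor v w ∧ T.Branch v w u then .eq else if u < v then .lt else .gt

theorem color_eq_mid {T : SignedDigraph n} {u v : Fin n} :
    T.color v u = .eq ↔ u = v ∨ ∃ w, T.MidNeighbor v w ∧ T.Branch v w u := by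
  unfold color; split_ifs <;> simp_all

theorem color_eq_lt {T : SignedDigraph n} {u v : Fin n} :
    T.color v u = .lt ↔ T.color v u ≠ .eq ∧ u < v := by
  unfold color; split_ifs <;> simp_all

theorem color_eq_gt {T : SignedDigraph n} {u v : Fin n} :
    T.color v u = .gt ↔ T.color v u ≠ .eq ∧ v < u := by
  unfold color; split_ifs <;> simp_all <;> omega

theorem color_congr {T : SignedDigraph n} {v u u' : Fin n}
    (h : T.color v u = .eq ↔ T.color v u' = .eq)
    (h' : T.color v u ≠ .eq → T.color v u' ≠ .eq → (u < v ↔ u' < v)) :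
    T.color v u = T.color v u' := by
  rw [color_eq_mid, color_eq_mid] at h
  rw [Ne, Ne, color_eq_mid, color_eq_mid] at h'
  unfold color
  split_ifs <;> simp_all

theorem MidNeighbor.adj {T : SignedDigraph n} (hT : T.IsCambrian) {v w : Fin n}
    (h : T.MidNeighbor v w) : T.graph.Adj v w := by
  rw [graph_adj]
  rcases h with h | h
  · exact ⟨(hT.arc_ne h.1).symm, .inr h.1⟩
  · exact ⟨hT.arc_ne h.1, .inl h.1⟩

theorem IsCambrian.color_neighbor {T : SignedDigraph n} (hT : T.IsCambrian) {v w : Fin n}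
    (h : T.graph.Adj v w) : T.color v w = .eq ↔ T.MidNeighbor v w := by
  rw [color_eq_mid]
  constructor
  · rintro (rfl | ⟨w', hw', hb⟩)
    · exact absurd rfl h.ne
    · rwa [← hT.branch_inj (hw'.adj hT) h hb]
  · exact fun hm => .inr ⟨w, hm, .refl h.ne'⟩

theorem IsCambrian.color_in {T : SignedDigraph n} (hT : T.IsCambrian) {v w : Fin n}
    (h : T.arc w v) : T.color v w = .eq ↔ T.sign v = true := by
  have hne := hT.arc_ne h
  rw [hT.color_neighbor (T.graph_adj.2 ⟨hne.symm, .inr h⟩), MidNeighbor]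
  have := hT.asymm _ _ h
  tauto

theorem IsCambrian.color_out {T : SignedDigraph n} (hT : T.IsCambrian) {v w : Fin n}
    (h : T.arc v w) : T.color v w = .eq ↔ T.sign v = false := by
  have hne := hT.arc_ne h
  rw [hT.color_neighbor (T.graph_adj.2 ⟨hne, .inl h⟩), MidNeighbor]
  have := hT.asymm _ _ h
  tauto

/-- The vertices of a left or right subtree are on the same side as its root. -/
theorem IsCambrian.branch_side {T : SignedDigraph n} (hT : T.IsCambrian) {v w u : Fin n}
    (h : T.graph.Adj v w) (hm : ¬ T.MidNeighbor v w) (hb : T.Branch v w u) :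
    (u < v ↔ w < v) := by
  rw [graph_adj] at h
  obtain ⟨hne, h⟩ := h
  simp only [MidNeighbor] at hm
  rcases lt_or_gt_of_ne hne with hlt | hlt
  · have : v < u := by
      rcases h with h | h
      · exact hT.pos_right v (by grind) w h hlt u hb
      · exact hT.neg_right v (by grind) w h hlt u hb
    omega
  · have : u < v := by
      rcases h with h | h
      · exact hT.pos_left v (by grind) w h hlt u hb
      · exact hT.neg_left v (by grind) w h hlt u hb
    omega

theorem IsCambrian.color_branch {T : SignedDigraph n} (hT : T.IsCambrian) {v w u : Fin n}
    (h : T.graph.Adj v w) (hb : T.Branch v w u) : T.color v u = T.color v w := by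
  have huv : u ≠ v := by
    rintro rfl
    obtain ⟨p, hp⟩ := hb
    exact hp p.end_mem_support
  have key : T.color v u = .eq ↔ T.color v w = .eq := by
    rw [hT.color_neighbor h, color_eq_mid]
    constructor
    · rintro (rfl | ⟨w', hw', p, hp⟩)
      · exact absurd rfl huv
      · obtain ⟨q, hq⟩ := hb
        have hbr : T.Branch v w' w :=
          ⟨p.append q.reverse, by simp [SimpleGraph.Walk.mem_support_append_iff, hp, hq]⟩
        rwa [← hT.branch_inj (hw'.adj hT) h hbr]
    · exact fun hm => .inr ⟨w, hm, hb⟩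
  refine color_congr key fun _ hn => ?_
  rw [Ne, hT.color_neighbor h] at hn
  exact hT.branch_side h hn hb

theorem IsCambrian.isColoring {T : SignedDigraph n} (hT : T.IsCambrian) :
    T.IsColoring T.color where
  conn := hT.connected
  adj_eq v u u' h hu hu' := by
    obtain ⟨w, hw, hb⟩ := exists_branch hT.connected hu
    have ha : T.graph.Adj u u' := T.graph_adj.2 ⟨hT.arc_ne h, .inl h⟩
    rw [hT.color_branch hw hb, hT.color_branch hw (hb.step ha hu')]
  in_mid v w h := hT.color_in h
  out_mid v w h := hT.color_out h
  inj v w w' h h' he := by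
    have h1 : ∀ x, T.color v x = .lt ↔ T.color v x ≠ .eq ∧ x < v := fun x => color_eq_lt
    have hin := fun x => hT.color_in (v := v) (w := x)
    have hout := fun x => hT.color_out (v := v) (w := x)
    have a1 := hT.neg_parent v
    have a2 := hT.neg_children v
    have a3 := hT.pos_child v
    have a4 := hT.pos_parents v
    have b1 := h1 w
    have b2 := h1 w'
    have c1 := hin w
    have c2 := hin w'
    have d1 := hout w
    have d2 := hout w'
    grind
  lt_of_lt v u h := (color_eq_lt.1 h).2
  lt_of_gt v u h := (color_eq_gt.1 h).2

namespace IsColoring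

variable {T : SignedDigraph n} {c : Fin n → Fin n → Ordering}

theorem asymm (hc : T.IsColoring c) {u v : Fin n} (h : T.arc u v) : ¬ T.arc v u := fun h' => by
  have h1 := hc.in_mid v u h
  have h2 := hc.out_mid v u h'
  grind

theorem arc_ne (hc : T.IsColoring c) {u v : Fin n} (h : T.arc u v) : u ≠ v := by
  rintro rfl
  exact hc.asymm h h

theorem color_self (hc : T.IsColoring c) (v : Fin n) : c v v = .eq := by
  have h1 := hc.lt_of_lt v v
  have h2 := hc.lt_of_gt v v
  cases h : c v v <;> simp_all

theorem color_branch (hc : T.IsColoring c) {v w u : Fin n} (h : T.Branch v w u) :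
    c v u = c v w := by
  obtain ⟨p, hp⟩ := h
  induction p with
  | nil => rfl
  | @cons a b d h p ih =>
    rw [SimpleGraph.Walk.support_cons, List.mem_cons, not_or] at hp
    rw [ih hp.2]
    have hb : b ≠ v := fun hb => hp.2 (hb ▸ p.start_mem_support)
    rcases (T.graph_adj.1 h).2 with h | h
    · exact (hc.adj_eq v _ _ h (Ne.symm hp.1) hb).symm
    · exact hc.adj_eq v _ _ h hb (Ne.symm hp.1)

/-- Every vertex other than `v` lies in the subtree of a neighbour of `v`. -/
theorem exists_toward (hc : T.IsColoring c) {v u : Fin n} (hu : u ≠ v) :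
    ∃ w, (T.arc v w ∨ T.arc w v) ∧ c v w = c v u ∧ T.Branch v w u := by
  obtain ⟨w, hw, hb⟩ := exists_branch hc.conn hu
  exact ⟨w, (T.graph_adj.1 hw).2, (hc.color_branch hb).symm, hb⟩

/-- A cycle leaves `v` through `w` and returns through `w'`, avoiding `v` in between. So `w` and
`w'` have the same colour at `v` and coincide, and the cycle repeats an edge. -/
theorem acyclic (hc : T.IsColoring c) : T.graph.IsAcyclic := by
  intro v p hp
  cases p with
  | nil => exact hp.ne_nil rfl
  | @cons _ w _ h p =>
    rw [SimpleGraph.Walk.cons_isCycle_iff] at hp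
    obtain ⟨hp, he⟩ := hp
    rw [← SimpleGraph.Walk.isPath_reverse_iff] at hp
    rw [← List.mem_reverse, ← SimpleGraph.Walk.edges_reverse] at he
    revert hp he
    generalize p.reverse = q
    intro hp he
    cases q with
    | nil => exact h.ne rfl
    | @cons _ w' _ h' q =>
      rw [SimpleGraph.Walk.cons_isPath_iff] at hp
      have := hc.color_branch ⟨q, hp.2⟩
      have := hc.inj v w w' (T.graph_adj.1 h).2 (T.graph_adj.1 h').2 this
      subst this
      simp at he

theorem isCambrian (hc : T.IsColoring c) : T.IsCambrian := by
  have hl := hc.lt_of_lt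
  have hg := hc.lt_of_gt
  refine ⟨fun u v h => hc.asymm h, hc.acyclic, hc.conn, ?_, ?_, ?_, ?_, ?_, ?_, ?_, ?_⟩
  · intro v hv w w' h h'
    have h1 := hc.out_mid v w h
    have h2 := hc.out_mid v w' h'
    exact hc.inj v w w' (.inl h) (.inl h') (by grind)
  · intro v hv w w' h h' hlt
    have h1 := hc.in_mid v w h
    have h2 := hc.in_mid v w' h'
    refine hc.inj v w w' (.inr h) (.inr h') ?_
    cases e : c v w <;> cases e' : c v w' <;> grind
  · intro v hv w h hlt u hb
    have h1 := hc.in_mid v w h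
    refine hl v u (hc.color_branch hb ▸ ?_)
    cases e : c v w <;> grind
  · intro v hv w h hlt u hb
    have h1 := hc.in_mid v w h
    refine hg v u (hc.color_branch hb ▸ ?_)
    cases e : c v w <;> grind
  · intro v hv w w' h h'
    have h1 := hc.in_mid v w h
    have h2 := hc.in_mid v w' h'
    exact hc.inj v w w' (.inr h) (.inr h') (by grind)
  · intro v hv w w' h h' hlt
    have h1 := hc.out_mid v w h
    have h2 := hc.out_mid v w' h'
    refine hc.inj v w w' (.inl h) (.inl h') ?_
    cases e : c v w <;> cases e' : c v w' <;> grind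
  · intro v hv w h hlt u hb
    have h1 := hc.out_mid v w h
    refine hl v u (hc.color_branch hb ▸ ?_)
    cases e : c v w <;> grind
  · intro v hv w h hlt u hb
    have h1 := hc.out_mid v w h
    refine hg v u (hc.color_branch hb ▸ ?_)
    cases e : c v w <;> grind

end IsColoring

/-! ### Duality and the partial order of a tree -/

/-- The opposite signed digraph: all arcs and all signs are reversed. -/
def op (T : SignedDigraph n) : SignedDigraph n where
  sign v := !T.sign v
  arc u v := T.arc v u

theorem op_sign (T : SignedDigraph n) (v : Fin n) : T.op.sign v = !T.sign v := rfl

theorem op_arc (T : SignedDigraph n) (u v : Fin n) : T.op.arc u v ↔ T.arc v u := Iff.rfl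

theorem op_op (T : SignedDigraph n) : T.op.op = T := by
  ext <;> simp [op]

theorem op_graph (T : SignedDigraph n) : T.op.graph = T.graph := by
  ext u v
  simp only [graph_adj, op]
  tauto

/-- The order of a signed digraph: there is a directed path from `u` to `v`. -/
def Below (T : SignedDigraph n) (u v : Fin n) : Prop := Relation.TransGen T.arc u v

theorem op_below {T : SignedDigraph n} {u v : Fin n} : T.op.Below u v ↔ T.Below v u :=
  Relation.transGen_swap

theorem Below.trans {T : SignedDigraph n} {u v w : Fin n} (h : T.Below u v) (h' : T.Below v w) :
    T.Below u w := Relation.TransGen.trans h h'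

theorem Below.of_arc {T : SignedDigraph n} {u v : Fin n} (h : T.arc u v) : T.Below u v :=
  Relation.TransGen.single h

/-- A height function is strictly increasing along arcs. -/
theorem Below.lt {T : SignedDigraph n} {α : Type*} [Preorder α] {f : Fin n → α}
    (hf : ∀ u v, T.arc u v → f u < f v) {u v : Fin n} (h : T.Below u v) : f u < f v := by
  induction h with
  | single h => exact hf _ _ h
  | tail _ h ih => exact ih.trans (hf _ _ h)

namespace IsColoring

variable {T : SignedDigraph n} {c : Fin n → Fin n → Ordering}

theorem op (hc : T.IsColoring c) : T.op.IsColoring c where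
  conn := by rw [op_graph]; exact hc.conn
  adj_eq v u u' h hu hu' := (hc.adj_eq v u' u h hu' hu).symm
  in_mid v w h := by simpa [SignedDigraph.op] using hc.out_mid v w h
  out_mid v w h := by simpa [SignedDigraph.op] using hc.in_mid v w h
  inj v w w' h h' := hc.inj v w w' h.symm h'.symm
  lt_of_lt := hc.lt_of_lt
  lt_of_gt := hc.lt_of_gt

/-- The first step of a directed path. -/
theorem below_toward (hc : T.IsColoring c) {u v : Fin n} (h : T.Below u v) :
    v ≠ u ∧ ∃ w, T.arc u w ∧ c u w = c u v := by
  induction h with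
  | single h => exact ⟨(hc.arc_ne h).symm, _, h, rfl⟩
  | @tail a b _ h ih =>
    obtain ⟨hne, w, hw, he⟩ := ih
    have hb : b ≠ u := by
      rintro rfl
      have := hc.inj b w a (.inl hw) (.inr h) he
      subst this
      exact hc.asymm hw h
    exact ⟨hb, w, hw, he.trans (hc.adj_eq u a b h hne hb)⟩

theorem below_irrefl (hc : T.IsColoring c) (u : Fin n) : ¬ T.Below u u :=
  fun h => (hc.below_toward h).1 rfl

theorem below_asymm (hc : T.IsColoring c) {u v : Fin n} (h : T.Below u v) : ¬ T.Below v u :=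
  fun h' => hc.below_irrefl u (h.trans h')

theorem below_wf (hc : T.IsColoring c) : WellFounded T.Below :=
  haveI : Std.Irrefl T.Below := ⟨hc.below_irrefl⟩
  haveI : IsTrans (Fin n) T.Below := ⟨fun _ _ _ => Below.trans⟩
  Finite.wellFounded_of_trans_of_irrefl T.Below

theorem color_eq_of_below (hc : T.IsColoring c) {a x y : Fin n} (h : T.Below a x)
    (h' : T.Below x y) : c a x = c a y := by
  induction h' with
  | single h' =>
    exact hc.adj_eq a _ _ h' (hc.below_toward h).1 (hc.below_toward (h.trans (Below.of_arc h'))).1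
  | tail h1 h2 ih =>
    exact ih.trans (hc.adj_eq a _ _ h2 (hc.below_toward (h.trans h1)).1
      (hc.below_toward (h.trans (h1.trans (Below.of_arc h2)))).1)

/-- Deleting `i → j` leaves two components, each recognizable by colours at the opposite end of the
arc. Along a walk to `i`, the side changes only across the arc itself. -/
theorem cut_arc (hc : T.IsColoring c) {i j : Fin n} (h : T.arc i j) (u : Fin n) :
    (u = i ∨ (u ≠ j ∧ c j u = c j i)) ↔ ¬ (u = j ∨ (u ≠ i ∧ c i u = c i j)) := by
  have hij := hc.arc_ne h
  obtain ⟨p⟩ := hc.conn u i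
  induction p with
  | nil => simp [hij]
  | @cons a b i ha p ih =>
    have ih := ih h hij
    have hab := (T.graph_adj.1 ha).1
    have h1 : a ≠ i → b ≠ i → c i a = c i b := fun h1 h2 => by
      rcases (T.graph_adj.1 ha).2 with h | h
      · exact hc.adj_eq _ _ _ h h1 h2
      · exact (hc.adj_eq _ _ _ h h2 h1).symm
    have h2 : a ≠ j → b ≠ j → c j a = c j b := fun h1 h2 => by
      rcases (T.graph_adj.1 ha).2 with h | h
      · exact hc.adj_eq _ _ _ h h1 h2
      · exact (hc.adj_eq _ _ _ h h2 h1).symm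
    have hadj := (T.graph_adj.1 ha).2
    have h3 := hc.inj i j a (.inl h)
    have h4 := hc.inj i j b (.inl h)
    have h5 := hc.inj j i a (.inr h)
    have h6 := hc.inj j i b (.inr h)
    grind

/-- The two ends of an edge do not both point to a third vertex. -/
theorem not_toward (hc : T.IsColoring c) {i j : Fin n} (h : T.arc i j ∨ T.arc j i) {u : Fin n}
    (hi : u ≠ i) (hj : u ≠ j) (h1 : c i u = c i j) : c j u ≠ c j i := by
  rcases h with h | h
  · have := hc.cut_arc h u
    grind
  · have := hc.cut_arc h u
    grind

/-- Arcs are cover relations: an intermediate `x` would lie beyond `b` as seen from `a`, and beyond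
`a` as seen from `b`. -/
theorem not_arc_of_below (hc : T.IsColoring c) {a x b : Fin n} (h : T.Below a x)
    (h' : T.Below x b) : ¬ T.arc a b := fun hab => by
  have h1 := hc.color_eq_of_below h h'
  have h2 := hc.op.color_eq_of_below (op_below.2 h') (op_below.2 h)
  exact hc.not_toward (.inl hab) (hc.below_toward h).1 (hc.op.below_toward (op_below.2 h')).1 h1 h2

/-! ### Peaks and valleys; a linear extension and the signs determine the tree -/

/-- A path that starts upwards is directed or has a first peak. -/
theorem below_or_peak (hc : T.IsColoring c) {a b a' : Fin n} (hab : b ≠ a) (ha : T.arc a a')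
    (he : c a a' = c a b) : T.Below a b ∨ ∃ w, T.sign w = false ∧ T.Below a w ∧
      c w a ≠ .eq ∧ c w b ≠ .eq ∧ c w a ≠ c w b := by
  induction a using hc.op.below_wf.induction generalizing a' with
  | _ a ih =>
  by_cases hb : a' = b
  · exact .inl (hb ▸ .of_arc ha)
  obtain ⟨a'', h, he', -⟩ := hc.exists_toward (Ne.symm hb)
  have hne : a'' ≠ a := by
    rintro rfl
    exact hc.not_toward (.inl ha) hab (Ne.symm hb) he.symm he'.symm
  rcases h with h | h
  · rcases ih a' (op_below.2 (.of_arc ha)) (Ne.symm hb) h he' with h1 | ⟨w, hw, h1, h2, h3⟩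
    · exact .inl ((Below.of_arc ha).trans h1)
    · have h4 := hc.adj_eq w a a' ha (by rintro rfl; exact hc.below_asymm (.of_arc ha) h1)
        (by rintro rfl; exact hc.below_irrefl _ h1)
      exact .inr ⟨w, hw, (Below.of_arc ha).trans h1, h4 ▸ h2, h3.1, h4 ▸ h3.2⟩
  -- The path turns down at `a'`, which thus has two distinct children on it. They have different
  -- colours there, which is impossible at a positive vertex, where every child is in the middle.
  · right
    have hca : c a' a ≠ c a' a'' := fun h' => hne (hc.inj a' a a'' (.inr ha) (.inr h) h').symm
    have h1 := hc.in_mid a' a ha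
    have h2 := hc.in_mid a' a'' h
    have hs : T.sign a' = false := by grind
    refine ⟨a', hs, .of_arc ha, ?_, ?_, ?_⟩ <;> grind

/-- A path that starts downwards is directed or has a first valley. -/
theorem below_or_valley (hc : T.IsColoring c) {a b a' : Fin n} (hab : b ≠ a) (ha : T.arc a' a)
    (he : c a a' = c a b) : T.Below b a ∨ ∃ w, T.sign w = true ∧ T.Below w a ∧
      c w a ≠ .eq ∧ c w b ≠ .eq ∧ c w a ≠ c w b := by
  simpa only [op_below, op_sign, Bool.not_eq_false'] using hc.op.below_or_peak hab ha he

/-- The vertices strictly between `a` and `b`. -/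
theorem between_of_color (hc : T.IsColoring c) {w a b : Fin n} (h1 : c w a ≠ .eq)
    (h2 : c w b ≠ .eq) (h3 : c w a ≠ c w b) : (a < w ∧ w < b) ∨ (b < w ∧ w < a) := by
  have h4 := hc.lt_of_lt w a
  have h5 := hc.lt_of_gt w a
  have h6 := hc.lt_of_lt w b
  have h7 := hc.lt_of_gt w b
  cases e : c w a <;> cases e' : c w b <;> simp_all

/-- A negative vertex strictly between the two ends of an arc is below this arc. -/
theorem below_of_between (hc : T.IsColoring c) {a b w : Fin n} (hab : T.arc a b)
    (hw : (a < w ∧ w < b) ∨ (b < w ∧ w < a)) (hs : T.sign w = false) : T.Below w a := by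
  have hwa : w ≠ a := by omega
  have hwb : w ≠ b := by omega
  have he := hc.adj_eq w a b hab hwa.symm hwb.symm
  -- The ends of the arc lie in one subtree of `w` but on both sides of its label, so this is the
  -- unconstrained subtree, above `w` since `w` is negative.
  have hmid : c w a = .eq := by
    have h4 := hc.lt_of_lt w a
    have h5 := hc.lt_of_gt w a
    have h6 := hc.lt_of_lt w b
    have h7 := hc.lt_of_gt w b
    cases e : c w a <;> simp_all <;> omega
  obtain ⟨x, hx, hcx, -⟩ := hc.exists_toward hwa.symm
  have hx : T.arc w x := by
    rcases hx with hx | hx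
    · exact hx
    · have := hc.in_mid w x hx
      grind
  rcases hc.below_or_peak hwa.symm hx hcx with h | ⟨t, ht, hwt, h1, h2, h3⟩
  · exact h
  -- The peak `t` lies strictly between `w` and `a`. Either `t = b`, or `a` and `b` are in the same
  -- subtree of `t` and `t` also lies strictly between `w` and `b`. Both contradict that `w` is
  -- between `a` and `b`.
  exfalso
  have hta : t ≠ a := by
    rintro rfl
    exact h2 (hc.color_self t)
  have hbt := hc.between_of_color h1 h2 h3
  by_cases htb : t = b
  · subst htb
    have g1 := hc.lt_of_lt t a
    have g2 := hc.lt_of_gt t a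
    have g3 := hc.lt_of_lt t w
    have g4 := hc.lt_of_gt t w
    cases e : c t a <;> cases e' : c t w <;> simp_all <;> omega
  · have := hc.adj_eq t a b hab hta.symm (Ne.symm htb)
    have := hc.between_of_color h1 (this ▸ h2) (this ▸ h3)
    omega

theorem below_of_between' (hc : T.IsColoring c) {a b w : Fin n} (hab : T.arc a b)
    (hw : (a < w ∧ w < b) ∨ (b < w ∧ w < a)) (hs : T.sign w = true) : T.Below b w :=
  op_below.1 (hc.op.below_of_between (T := T.op) hab (Or.symm hw) (by simp [SignedDigraph.op, hs]))

/-- Two Cambrian trees with the same signs and a common height function: every arc of the first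
one is a relation of the second one. -/
theorem below_of_arc {S : SignedDigraph n} {d : Fin n → Fin n → Ordering} (hc : T.IsColoring c)
    (hd : S.IsColoring d) (hs : S.sign = T.sign) {α : Type*} [Preorder α] {f : Fin n → α}
    (hf : ∀ u v, T.arc u v → f u < f v) (hg : ∀ u v, S.arc u v → f u < f v) {a b : Fin n}
    (h : T.arc a b) : S.Below a b := by
  have hab := hf a b h
  have hne := (hc.arc_ne h).symm
  obtain ⟨x, hx, hcx, -⟩ := hd.exists_toward hne
  rcases hx with hx | hx
  · rcases hd.below_or_peak hne hx hcx with h' | ⟨t, ht, hwt, h1, h2, h3⟩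
    · exact h'
    -- The peak is above `a` in `S`, but as a negative vertex between the ends of an arc of `T` it
    -- is below `a` in `T`.
    · have h4 := hc.below_of_between h (hd.between_of_color h1 h2 h3) (hs ▸ ht)
      exact absurd ((hwt.lt hg).trans (h4.lt hf)) (lt_irrefl _)
  · exfalso
    rcases hd.below_or_valley hne hx hcx with h' | ⟨t, ht, hwt, h1, h2, h3⟩
    · exact lt_irrefl _ (hab.trans (h'.lt hg))
    · have h4 := hc.below_of_between' h (hd.between_of_color h1 h2 h3) (hs ▸ ht)
      exact lt_irrefl _ (hab.trans ((h4.lt hf).trans (hwt.lt hg)))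

/-- By `below_of_arc` in both directions the two trees define the same order, and arcs are its
covers. -/
theorem arc_of_arc {S : SignedDigraph n} {d : Fin n → Fin n → Ordering} (hc : T.IsColoring c)
    (hd : S.IsColoring d) (hs : S.sign = T.sign) {α : Type*} [Preorder α] {f : Fin n → α}
    (hf : ∀ u v, T.arc u v → f u < f v) (hg : ∀ u v, S.arc u v → f u < f v) {a b : Fin n}
    (h : T.arc a b) : S.arc a b := by
  have hsub : ∀ {u v}, S.Below u v → T.Below u v := fun h => by
    induction h with
    | single h => exact hd.below_of_arc hc hs.symm hg hf h
    | tail _ h ih => exact ih.trans (hd.below_of_arc hc hs.symm hg hf h)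
  obtain ⟨x, h1, h2⟩ := Relation.TransGen.head'_iff.1 (hc.below_of_arc hd hs hf hg h)
  rcases Relation.reflTransGen_iff_eq_or_transGen.1 h2 with rfl | h2
  · exact h1
  · exact absurd h (hc.not_arc_of_below (hsub (.of_arc h1)) (hsub h2))

end IsColoring

/-! ### Rotations preserve Cambrian trees -/

/-- The rotation of the arc `i → j`. -/
def rotate (T : SignedDigraph n) (i j : Fin n) : SignedDigraph n where
  sign := T.sign
  arc u v :=
    (u = j ∧ v = i) ∨ ((T.arc u i ∧ (T.sign i = false → i < u)) ∧ v = j) ∨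
      (u = i ∧ (T.arc j v ∧ (T.sign j = true → v < j))) ∨
        (T.arc u v ∧ ¬ (u = i ∧ v = j) ∧ ¬ ((T.arc u i ∧ (T.sign i = false → i < u)) ∧ v = i) ∧
          ¬ (u = j ∧ (T.arc j v ∧ (T.sign j = true → v < j))))

theorem rotatesAt_iff {T S : SignedDigraph n} {i j : Fin n} :
    T.RotatesAt S i j ↔ T.arc i j ∧ S = T.rotate i j := by
  unfold RotatesAt rotate
  refine and_congr_right fun _ => ⟨fun ⟨h1, h2⟩ => ?_, fun h => ?_⟩
  · ext u v
    · rw [h1]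
    · exact h2 u v
  · subst h
    exact ⟨rfl, fun u v => Iff.rfl⟩

/-- The colour of the remaining incoming subtree of `i`. -/
def inSlot (T : SignedDigraph n) (i : Fin n) : Ordering := if T.sign i = true then .eq else .gt

/-- The colour of the remaining outgoing subtree of `j`. -/
def outSlot (T : SignedDigraph n) (j : Fin n) : Ordering := if T.sign j = true then .lt else .eq

/-- The colouring of the rotation of the arc `i → j`. -/
def rotateColor (T : SignedDigraph n) (c : Fin n → Fin n → Ordering) (i j v u : Fin n) :
    Ordering :=
  if u = v then .eq
  else if v = i then
    if c i u = .lt then .lt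
    else if u ≠ j ∧ c j u = T.outSlot j then (if T.sign i = true then .gt else .eq)
    else T.inSlot i
  else if v = j then
    if c j u = .gt then .gt
    else if u ≠ i ∧ c i u = T.inSlot i then (if T.sign j = true then .eq else .lt)
    else T.outSlot j
  else c v u

theorem ordering_cases (o : Ordering) : o = .lt ∨ o = .eq ∨ o = .gt := by
  cases o <;> simp

namespace IsColoring

variable {T : SignedDigraph n} {c : Fin n → Fin n → Ordering}

theorem inSlot_iff (hc : T.IsColoring c) {i b : Fin n} (h : T.arc b i) :
    (T.sign i = false → i < b) ↔ c i b = T.inSlot i := by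
  have h1 := hc.in_mid i b h
  have h2 := hc.lt_of_lt i b
  have h3 := hc.lt_of_gt i b
  unfold inSlot
  cases e : c i b <;> grind

theorem outSlot_iff (hc : T.IsColoring c) {j a : Fin n} (h : T.arc j a) :
    (T.sign j = true → a < j) ↔ c j a = T.outSlot j := by
  have h1 := hc.out_mid j a h
  have h2 := hc.lt_of_lt j a
  have h3 := hc.lt_of_gt j a
  unfold outSlot
  cases e : c j a <;> grind

theorem color_tail (hc : T.IsColoring c) {i j : Fin n} (h : T.arc i j) (hij : i < j) :
    c i j = if T.sign i = true then .gt else .eq := by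
  have h1 := hc.out_mid i j h
  have h2 := hc.lt_of_lt i j
  cases e : c i j <;> grind

theorem color_head (hc : T.IsColoring c) {i j : Fin n} (h : T.arc i j) (hij : i < j) :
    c j i = if T.sign j = true then .eq else .lt := by
  have h1 := hc.in_mid j i h
  have h2 := hc.lt_of_gt j i
  cases e : c j i <;> grind

theorem rotate_arc (hc : T.IsColoring c) (i j u v : Fin n) : (T.rotate i j).arc u v ↔
    (u = j ∧ v = i) ∨ (T.arc u i ∧ c i u = T.inSlot i ∧ v = j) ∨
      (u = i ∧ T.arc j v ∧ c j v = T.outSlot j) ∨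
        (T.arc u v ∧ ¬ (u = i ∧ v = j) ∧ (v = i → c i u ≠ T.inSlot i) ∧
          (u = j → c j v ≠ T.outSlot j)) := by
  have h1 : (T.arc u i ∧ (T.sign i = false → i < u)) ↔ T.arc u i ∧ c i u = T.inSlot i :=
    and_congr_right fun h => hc.inSlot_iff h
  have h2 : (T.arc j v ∧ (T.sign j = true → v < j)) ↔ T.arc j v ∧ c j v = T.outSlot j :=
    and_congr_right fun h => hc.outSlot_iff h
  simp only [rotate, h1, h2]
  grind

/-- Every old arc survives, is reversed, or is replaced by a path of length two through the new arc
`j → i`. -/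
theorem rotate_conn (hc : T.IsColoring c) {i j : Fin n} :
    (T.rotate i j).graph.Preconnected := by
  have key : ∀ {u v}, (T.rotate i j).arc u v → (T.rotate i j).graph.Reachable u v := by
    intro u v huv
    by_cases hne : u = v
    · rw [hne]
    · exact SimpleGraph.Adj.reachable ((graph_adj _).2 ⟨hne, .inl huv⟩)
  have hr := hc.rotate_arc i j
  have hji : (T.rotate i j).graph.Reachable j i := key ((hr j i).2 (.inl ⟨rfl, rfl⟩))
  have harc : ∀ {u v}, T.arc u v → (T.rotate i j).graph.Reachable u v := by
    intro u v huv
    by_cases h1 : u = i ∧ v = j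
    · rw [h1.1, h1.2]
      exact hji.symm
    by_cases h2 : v = i ∧ c i u = T.inSlot i
    · have : (T.rotate i j).arc u j := (hr u j).2 (.inr (.inl ⟨h2.1 ▸ huv, h2.2, rfl⟩))
      rw [h2.1]
      exact (key this).trans hji
    by_cases h3 : u = j ∧ c j v = T.outSlot j
    · have : (T.rotate i j).arc i v := (hr i v).2 (.inr (.inr (.inl ⟨rfl, h3.1 ▸ huv, h3.2⟩)))
      rw [h3.1]
      exact hji.trans (key this)
    · exact key ((hr u v).2 (.inr (.inr (.inr ⟨huv, h1, by tauto, by tauto⟩))))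
  intro u v
  obtain ⟨p⟩ := hc.conn u v
  induction p with
  | nil => rfl
  | cons ha _ ih =>
    rcases (T.graph_adj.1 ha).2 with h | h
    · exact (harc h).trans ih
    · exact (harc h).symm.trans ih

theorem rotateColor_of_ne {i j v : Fin n} (hc : T.IsColoring c) (hi : v ≠ i) (hj : v ≠ j)
    (u : Fin n) : T.rotateColor c i j v u = c v u := by
  unfold rotateColor
  have := hc.color_self v
  grind

/-- The neighbours of `i` after the rotation. -/
theorem rotate_neighbor_tail (hc : T.IsColoring c) {i j : Fin n} (h : T.arc i j) (hij : i < j)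
    (w : Fin n) (hw : (T.rotate i j).arc i w ∨ (T.rotate i j).arc w i) :
    (w = j ∧ T.rotateColor c i j i w = T.inSlot i) ∨
    (T.arc j w ∧ c j w = T.outSlot j ∧
      T.rotateColor c i j i w = if T.sign i = true then .gt else .eq) ∨
    ((T.arc i w ∨ T.arc w i) ∧ c i w = .lt ∧ T.rotateColor c i j i w = .lt) := by
  have hne := hij.ne
  have hi := hc.color_tail h hij
  have hj := hc.color_head h hij
  rw [hc.rotate_arc, hc.rotate_arc] at hw
  have hii : ¬ T.arc i i := fun h => hc.arc_ne h rfl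
  have cut := hc.cut_arc h w
  have i1 := hc.inj i j w
  have m1 := hc.in_mid i w
  have m2 := hc.out_mid i w
  have as := hc.asymm h
  by_cases hwj : w = j
  · left
    subst hwj
    simp only [rotateColor, inSlot, outSlot] at *
    grind
  by_cases hA : T.arc j w ∧ c j w = T.outSlot j
  · right; left
    simp only [rotateColor, inSlot, outSlot] at *
    grind
  have hw : (T.arc i w ∨ T.arc w i) ∧ (T.arc w i → c i w ≠ T.inSlot i) := by
    grind
  right; right
  refine ⟨hw.1, ?_⟩
  have : c i w = .lt := by
    simp only [inSlot] at *
    rcases ordering_cases (c i w) with e | e | e <;> grind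
  simp only [rotateColor, inSlot, outSlot] at *
  grind

/-- The neighbours of `j` after the rotation. -/
theorem rotate_neighbor_head (hc : T.IsColoring c) {i j : Fin n} (h : T.arc i j) (hij : i < j)
    (w : Fin n) (hw : (T.rotate i j).arc j w ∨ (T.rotate i j).arc w j) :
    (w = i ∧ T.rotateColor c i j j w = T.outSlot j) ∨
    (T.arc w i ∧ c i w = T.inSlot i ∧
      T.rotateColor c i j j w = if T.sign j = true then .eq else .lt) ∨
    ((T.arc j w ∨ T.arc w j) ∧ c j w = .gt ∧ T.rotateColor c i j j w = .gt) := by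
  have hne := hij.ne
  have hi := hc.color_tail h hij
  have hj := hc.color_head h hij
  rw [hc.rotate_arc, hc.rotate_arc] at hw
  have hjj : ¬ T.arc j j := fun h => hc.arc_ne h rfl
  have cut := hc.cut_arc h w
  have i1 := hc.inj j i w
  have m1 := hc.in_mid j w
  have m2 := hc.out_mid j w
  have as := hc.asymm h
  by_cases hwi : w = i
  · left
    subst hwi
    simp only [rotateColor, inSlot, outSlot] at *
    grind
  by_cases hB : T.arc w i ∧ c i w = T.inSlot i
  · right; left
    simp only [rotateColor, inSlot, outSlot] at *
    grind
  have hw : (T.arc j w ∨ T.arc w j) ∧ (T.arc j w → c j w ≠ T.outSlot j) := by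
    grind
  right; right
  refine ⟨hw.1, ?_⟩
  have : c j w = .gt := by
    simp only [outSlot] at *
    rcases ordering_cases (c j w) with e | e | e <;> grind
  simp only [rotateColor, inSlot, outSlot] at *
  grind

theorem rotate_inj (hc : T.IsColoring c) {i j : Fin n} (h : T.arc i j) (hij : i < j)
    (v w w' : Fin n) (hw : (T.rotate i j).arc v w ∨ (T.rotate i j).arc w v)
    (hw' : (T.rotate i j).arc v w' ∨ (T.rotate i j).arc w' v)
    (he : T.rotateColor c i j v w = T.rotateColor c i j v w') : w = w' := by
  have inj := hc.inj v w w'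
  by_cases hvi : v = i
  · subst hvi
    have i3 := hc.inj j w w'
    have h1 := hc.rotate_neighbor_tail h hij w hw
    have h2 := hc.rotate_neighbor_tail h hij w' hw'
    unfold inSlot at h1 h2
    grind
  by_cases hvj : v = j
  · subst hvj
    have i3 := hc.inj i w w'
    have h1 := hc.rotate_neighbor_head h hij w hw
    have h2 := hc.rotate_neighbor_head h hij w' hw'
    unfold outSlot at h1 h2
    grind
  rw [hc.rotate_arc, hc.rotate_arc] at hw hw'
  rw [hc.rotateColor_of_ne hvi hvj, hc.rotateColor_of_ne hvi hvj] at he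
  have a1 := hc.adj_eq v i j h (Ne.symm hvi) (Ne.symm hvj)
  have i1 := hc.inj v i w
  have i2 := hc.inj v i w'
  have i3 := hc.inj v j w
  have i4 := hc.inj v j w'
  have i5 := hc.inj v i j
  have as : ∀ x y, T.arc x y → ¬ T.arc y x := fun x y hx => hc.asymm hx
  have nt := hc.not_toward (.inl h) hvi hvj
  grind

theorem rotate_adj_eq (hc : T.IsColoring c) {i j : Fin n} (h : T.arc i j) (hij : i < j)
    (v u u' : Fin n) (huu : (T.rotate i j).arc u u') (hu : u ≠ v) (hu' : u' ≠ v) :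
    T.rotateColor c i j v u = T.rotateColor c i j v u' := by
  rw [hc.rotate_arc] at huu
  have hne := hij.ne
  have hi := hc.color_tail h hij
  have hj := hc.color_head h hij
  by_cases hvi : v = i
  · subst hvi
    have cut := hc.cut_arc h
    have e1 := hc.adj_eq v u u'
    have e2 := hc.adj_eq j u u'
    have e3 := hc.in_mid j u
    have := cut u
    have := cut u'
    simp only [rotateColor, inSlot, outSlot] at *
    grind
  by_cases hvj : v = j
  · subst hvj
    have cut := hc.cut_arc h
    have e1 := hc.adj_eq v u u'
    have e2 := hc.adj_eq i u u'
    have e3 := hc.out_mid i u'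
    have := cut u
    have := cut u'
    simp only [rotateColor, inSlot, outSlot] at *
    grind
  rw [hc.rotateColor_of_ne hvi hvj, hc.rotateColor_of_ne hvi hvj]
  have e := hc.adj_eq v
  grind

theorem rotate_in_mid (hc : T.IsColoring c) {i j : Fin n} (h : T.arc i j) (hij : i < j)
    (v w : Fin n) (hw : (T.rotate i j).arc w v) :
    T.rotateColor c i j v w = .eq ↔ T.sign v = true := by
  rw [hc.rotate_arc] at hw
  have hne := hij.ne
  have hi := hc.color_tail h hij
  have hj := hc.color_head h hij
  have cut := hc.cut_arc h w
  have e1 := hc.in_mid v w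
  have e2 := hc.out_mid v w
  have e3 := hc.in_mid i w
  have e4 := hc.arc_ne (u := w) (v := v)
  have e5 := hc.arc_ne (u := w) (v := i)
  have e6 := hc.out_mid j v
  have e8 := hc.inj j i w
  have e9 := ordering_cases (c v w)
  have e7 := hc.adj_eq v
  have irr : ∀ x, ¬ T.arc x x := fun x hx => hc.arc_ne hx rfl
  by_cases hvi : v = i
  · subst hvi
    simp only [rotateColor, inSlot, outSlot] at *
    grind
  by_cases hvj : v = j
  · subst hvj
    simp only [rotateColor, inSlot, outSlot] at *
    grind
  rw [hc.rotateColor_of_ne hvi hvj]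
  have := hc.in_mid v j
  grind

theorem rotate_out_mid (hc : T.IsColoring c) {i j : Fin n} (h : T.arc i j) (hij : i < j)
    (v w : Fin n) (hw : (T.rotate i j).arc v w) :
    T.rotateColor c i j v w = .eq ↔ T.sign v = false := by
  rw [hc.rotate_arc] at hw
  have hne := hij.ne
  have hi := hc.color_tail h hij
  have hj := hc.color_head h hij
  have cut := hc.cut_arc h w
  have e1 := hc.in_mid v w
  have e2 := hc.out_mid v w
  have e3 := hc.out_mid j w
  have e4 := hc.arc_ne (u := v) (v := w)
  have e5 := hc.arc_ne (u := j) (v := w)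
  have e6 := hc.in_mid i v
  have e8 := hc.inj i j w
  have e9 := ordering_cases (c v w)
  have e7 := hc.adj_eq v
  have irr : ∀ x, ¬ T.arc x x := fun x hx => hc.arc_ne hx rfl
  by_cases hvi : v = i
  · subst hvi
    simp only [rotateColor, inSlot, outSlot] at *
    grind
  by_cases hvj : v = j
  · subst hvj
    simp only [rotateColor, inSlot, outSlot] at *
    grind
  rw [hc.rotateColor_of_ne hvi hvj]
  have := hc.out_mid v i
  grind

/-- Only the left slot of `j` changes. If `j` is positive it receives `i` with `L` and `A`, where
`A` was already there and the labels in `L` are below `i < j`. If `j` is negative it keeps `B`,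
which was in its left subtree together with `i`. -/
theorem rotate_lt (hc : T.IsColoring c) {i j : Fin n} (h : T.arc i j) (hij : i < j)
    (v u : Fin n) (hl : T.rotateColor c i j v u = .lt) : u < v := by
  have hne := hij.ne
  have hi := hc.color_tail h hij
  have hj := hc.color_head h hij
  have cut := hc.cut_arc h u
  have l1 := hc.lt_of_lt v u
  have l2 := hc.lt_of_lt i u
  simp only [rotateColor, inSlot, outSlot] at *
  cases e : c j u <;> cases e' : c i u <;> grind

/-- The mirror image of `rotate_lt`: only the right slot of `i` changes. -/
theorem rotate_gt (hc : T.IsColoring c) {i j : Fin n} (h : T.arc i j) (hij : i < j)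
    (v u : Fin n) (hl : T.rotateColor c i j v u = .gt) : v < u := by
  have hne := hij.ne
  have hi := hc.color_tail h hij
  have hj := hc.color_head h hij
  have cut := hc.cut_arc h u
  have l1 := hc.lt_of_gt v u
  have l2 := hc.lt_of_gt j u
  simp only [rotateColor, inSlot, outSlot] at *
  cases e : c j u <;> cases e' : c i u <;> grind

theorem rotate (hc : T.IsColoring c) {i j : Fin n} (h : T.arc i j) (hij : i < j) :
    (T.rotate i j).IsColoring (T.rotateColor c i j) where
  conn := hc.rotate_conn
  adj_eq := hc.rotate_adj_eq h hij
  in_mid := hc.rotate_in_mid h hij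
  out_mid := hc.rotate_out_mid h hij
  inj := hc.rotate_inj h hij
  lt_of_lt := hc.rotate_lt h hij
  lt_of_gt := hc.rotate_gt h hij

end IsColoring

end SignedDigraph

/-- Sorting the values of an injective function. -/
theorem exists_perm_symm_lt_iff {n : ℕ} {α : Type*} [LinearOrder α] {f : Fin n → α}
    (hf : Function.Injective f) :
    ∃ σ : Equiv.Perm (Fin n), ∀ u v, σ.symm u < σ.symm v ↔ f u < f v := by
  have hm : StrictMono (f ∘ Tuple.sort f) :=
    (Tuple.monotone_sort f).strictMono_of_injective (hf.comp (Tuple.sort f).injective)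
  refine ⟨Tuple.sort f, fun u v => ?_⟩
  rw [← hm.lt_iff_lt]
  simp

namespace SignedDigraph

variable {n m : ℕ}

/-! ### Decreasing relations under rotation -/

/-- The decreasing relations of a signed digraph. -/
def Desc (T : SignedDigraph n) (x y : Fin n) : Prop := T.Below x y ∧ y < x

namespace IsColoring

variable {T : SignedDigraph n} {c : Fin n → Fin n → Ordering}

/-- Rotating back, in the opposite tree. -/
theorem rotate_op_rotate (hc : T.IsColoring c) {i j : Fin n} (h : T.arc i j) (hij : i < j) :
    (T.rotate i j).op.rotate i j = T.op := by
  ext u v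
  · simp [SignedDigraph.rotate, SignedDigraph.op]
  have hs : (T.rotate i j).sign = T.sign := rfl
  have hr := (hc.rotate h hij).op.rotate_arc i j u v
  have e := hc.rotate_arc i j
  have t1 := fun w => hc.rotate_neighbor_tail h hij w
  have t2 := fun w => hc.rotate_neighbor_head h hij w
  have as : ∀ x y, T.arc x y → ¬ T.arc y x := fun x y hx => hc.asymm hx
  have irr : ∀ x, ¬ T.arc x x := fun x hx => hc.arc_ne hx rfl
  have ct := hc.color_tail h hij
  have ch := hc.color_head h hij
  have hi : (T.rotate i j).op.inSlot i = if T.sign i = true then .gt else .eq := by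
    simp only [inSlot, op_sign, hs]
    cases T.sign i <;> rfl
  have hj : (T.rotate i j).op.outSlot j = if T.sign j = true then .eq else .lt := by
    simp only [outSlot, op_sign, hs]
    cases T.sign j <;> rfl
  rw [hr, op_arc, op_arc, op_arc, op_arc, hi, hj]
  have hA : ∀ w, ((T.rotate i j).arc i w ∧
      T.rotateColor c i j i w = if T.sign i = true then .gt else .eq) ↔
      T.arc j w ∧ c j w = T.outSlot j := by
    intro w
    have := t1 w
    have e1 := e i w
    have cut := hc.cut_arc h w
    constructor
    · unfold inSlot at *
      grind
    · intro hw
      have hA := e1.2 (.inr (.inr (.inl ⟨rfl, hw⟩)))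
      have := as i j h
      unfold inSlot outSlot at *
      grind
  have hB : ∀ w, ((T.rotate i j).arc w j ∧
      T.rotateColor c i j j w = if T.sign j = true then .eq else .lt) ↔
      T.arc w i ∧ c i w = T.inSlot i := by
    intro w
    have := t2 w
    have e1 := e w j
    have cut := hc.cut_arc h w
    constructor
    · unfold outSlot at *
      grind
    · intro hw
      have hB := e1.2 (.inr (.inl ⟨hw.1, hw.2, rfl⟩))
      have := as i j h
      unfold inSlot outSlot at *
      grind
  have tri1 : ∀ w, T.arc w i → ¬ T.arc w j := fun w hw =>
    hc.not_arc_of_below (.of_arc hw) (.of_arc h)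
  have tri2 : ∀ w, T.arc j w → ¬ T.arc i w := fun w hw =>
    hc.not_arc_of_below (.of_arc h) (.of_arc hw)
  clear hr t1 t2 hi hj
  have hA' := hA u
  have hB' := hB v
  have e' := e v u
  grind

/-- The relations that are created by a rotation. -/
theorem below_rotate (hc : T.IsColoring c) {i j : Fin n} (h : T.arc i j) (hij : i < j)
    {x y : Fin n} (hb : (T.rotate i j).Below x y) : T.Below x y ∨
      ((x = j ∨ (T.Below x j ∧ c j x = .gt)) ∧ (y = i ∨ (T.Below i y ∧ c i y = .lt))) := by
  have hne := hij.ne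
  induction hb using Relation.TransGen.head_induction_on with
  | @single x hxy =>
    rw [hc.rotate_arc] at hxy
    rcases hxy with ⟨rfl, rfl⟩ | ⟨h1, -, rfl⟩ | ⟨rfl, h1, -⟩ | ⟨h1, -⟩
    · exact .inr ⟨.inl rfl, .inl rfl⟩
    · exact .inl ((Below.of_arc h1).trans (.of_arc h))
    · exact .inl ((Below.of_arc h).trans (.of_arc h1))
    · exact .inl (.of_arc h1)
  | @head x x' hx hb ih =>
    have hx0 := hx
    rw [hc.rotate_arc] at hx
    rcases hx with ⟨rfl, rfl⟩ | ⟨h1, -, rfl⟩ | ⟨rfl, h1, -⟩ | ⟨h1, h2, h3, h4⟩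
    · have hyx : y ≠ x := by
        rintro rfl
        exact (hc.rotate h hij).below_asymm hb (.of_arc hx0)
      rcases ih with ih | ⟨-, hY⟩
      · obtain ⟨w, hw, hwy⟩ := Relation.TransGen.head'_iff.1 ih
        have hwy := Relation.reflTransGen_iff_eq_or_transGen.1 hwy
        by_cases hwx : w = x
        · subst hwx
          exact .inl (hwy.resolve_left hyx)
        · refine .inr ⟨.inl rfl, .inr ⟨ih, ?_⟩⟩
          -- Here `x` is `j` and `x'` is `i`. A parent of `i` other than `j` exists only if `i` is
          -- positive, and it is the left one because `j` is on the right.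
          have hcw : c x' w = .lt := by
            have i1 := hc.inj x' x w
            have m1 := hc.out_mid x' x h
            have m2 := hc.out_mid x' w hw
            have m3 := hc.color_tail h hij
            rcases ordering_cases (c x' w) with e | e | e <;> grind
          rcases hwy with rfl | hwy
          · exact hcw
          · rw [← hcw]
            exact (hc.color_eq_of_below (.of_arc hw) hwy).symm
      · exact .inr ⟨.inl rfl, hY⟩
    · rcases ih with ih | ⟨-, rfl | ⟨hY, -⟩⟩
      · exact .inl ((Below.of_arc h1).trans ((Below.of_arc h).trans ih))
      · exact .inl (.of_arc h1)
      · exact .inl ((Below.of_arc h1).trans hY)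
    · rcases ih with ih | ⟨rfl | ⟨hX, -⟩, -⟩
      · exact .inl ((Below.of_arc h).trans ((Below.of_arc h1).trans ih))
      · exact absurd rfl (hc.arc_ne h1)
      · exact absurd hX (hc.below_asymm (.of_arc h1))
    · rcases ih with ih | ⟨hX, hY⟩
      · exact .inl ((Below.of_arc h1).trans ih)
      · refine .inr ⟨.inr ?_, hY⟩
        rcases hX with rfl | ⟨hX, hcx⟩
        · refine ⟨.of_arc h1, ?_⟩
          have i1 := hc.inj x' i x
          have m1 := hc.in_mid x' i h
          have m2 := hc.in_mid x' x h1
          have m3 := hc.color_head h hij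
          rcases ordering_cases (c x' x) with e | e | e <;> grind
        · refine ⟨(Below.of_arc h1).trans hX, ?_⟩
          rw [hc.adj_eq j x x' h1 ?_ (hc.below_toward hX).1.symm, hcx]
          rintro rfl
          exact hc.below_asymm hX (.of_arc h1)

/-- Reading the rotation backwards in the opposite tree, `below_rotate` describes the relations that
are lost: they go from labels at most `i` to labels at least `j`, hence are increasing. -/
theorem desc_rotate (hc : T.IsColoring c) {i j : Fin n} (h : T.arc i j) (hij : i < j)
    {x y : Fin n} (hxy : T.Desc x y) : (T.rotate i j).Desc x y := by
  refine ⟨?_, hxy.2⟩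
  have hd := hc.rotate h hij
  have har : (T.rotate i j).op.arc i j := (hc.rotate_arc i j j i).2 (.inl ⟨rfl, rfl⟩)
  have key := hd.op.below_rotate har hij (x := y) (y := x)
  rw [hc.rotate_op_rotate h hij, op_below, op_below] at key
  rcases key hxy.1 with h1 | ⟨h1, h2⟩
  · exact h1
  · exfalso
    have hlt := hxy.2
    have hy : j ≤ y := by
      rcases h1 with rfl | ⟨-, h1⟩
      · exact le_rfl
      · exact (hd.lt_of_gt _ _ h1).le
    have hx : x ≤ i := by
      rcases h2 with rfl | ⟨-, h2⟩
      · exact le_rfl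
      · exact (hd.lt_of_lt _ _ h2).le
    omega

theorem desc_rotate_self (hc : T.IsColoring c) {i j : Fin n} (hij : i < j) :
    (T.rotate i j).Desc j i :=
  ⟨.of_arc ((hc.rotate_arc i j j i).2 (.inl ⟨rfl, rfl⟩)), hij⟩

/-- A height function that is compatible with the decreasing relations of a tree and violates
an increasing arc is compatible with the decreasing relations of the rotated tree. -/
theorem lt_of_desc_rotate (hc : T.IsColoring c) {i j : Fin n} (h : T.arc i j) (hij : i < j)
    {α : Type*} [Preorder α] {f : Fin n → α} (hf : ∀ x y, T.Desc x y → f x < f y)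
    (hji : f j < f i) {x y : Fin n} (hxy : (T.rotate i j).Desc x y) : f x < f y := by
  rcases hc.below_rotate h hij hxy.1 with h1 | ⟨h1, h2⟩
  · exact hf x y ⟨h1, hxy.2⟩
  · have hx : f x ≤ f j := by
      rcases h1 with rfl | ⟨h1, h3⟩
      · exact le_rfl
      · exact (hf _ _ ⟨h1, hc.lt_of_gt _ _ h3⟩).le
    have hy : f i ≤ f y := by
      rcases h2 with rfl | ⟨h2, h3⟩
      · exact le_rfl
      · exact (hf _ _ ⟨h2, hc.lt_of_lt _ _ h3⟩).le
    exact hx.trans_lt (hji.trans_le hy)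

end IsColoring

end SignedDigraph

/-! ### The rotation order in terms of decreasing relations -/

namespace CambTree

variable {n m : ℕ}

theorem isColoring (T : CambTree n) : T.1.IsColoring T.1.color := T.2.isColoring

/-- The number of decreasing relations. -/
noncomputable def descCount (T : CambTree n) : ℕ := {p : Fin n × Fin n | T.1.Desc p.1 p.2}.ncard

theorem descCount_le (T : CambTree n) : T.descCount ≤ n * n := by
  have := Set.ncard_le_card {p : Fin n × Fin n | T.1.Desc p.1 p.2}
  simpa [descCount] using this

theorem IncreasingRotation.exists_eq {T S : CambTree n} (h : T.IncreasingRotation S) :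
    ∃ i j, i < j ∧ T.1.arc i j ∧ S.1 = T.1.rotate i j := by
  obtain ⟨i, j, hij, h⟩ := h
  exact ⟨i, j, hij, SignedDigraph.rotatesAt_iff.1 h⟩

theorem IncreasingRotation.sign_eq {T S : CambTree n} (h : T.IncreasingRotation S) :
    S.1.sign = T.1.sign := by
  obtain ⟨i, j, hij, h, hS⟩ := h.exists_eq
  rw [hS]
  rfl

theorem IncreasingRotation.desc {T S : CambTree n} (h : T.IncreasingRotation S) {x y : Fin n}
    (hxy : T.1.Desc x y) : S.1.Desc x y := by
  obtain ⟨i, j, hij, h, hS⟩ := h.exists_eq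
  rw [hS]
  exact T.isColoring.desc_rotate h hij hxy

/-- No decreasing relation is lost, and the one from `j` to `i` is new. This potential gives
termination of the rotation process and triangularity. -/
theorem IncreasingRotation.descCount_lt {T S : CambTree n} (h : T.IncreasingRotation S) :
    T.descCount < S.descCount := by
  refine Set.ncard_lt_ncard ⟨fun p hp => h.desc hp, fun hsub => ?_⟩ (Set.toFinite _)
  obtain ⟨i, j, hij, h, hS⟩ := h.exists_eq
  have h1 : S.1.Desc j i := hS ▸ T.isColoring.desc_rotate_self hij
  exact T.isColoring.below_asymm (.of_arc h) (hsub (a := (j, i)) h1).1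

theorem Le.refl (T : CambTree n) : T.Le T := Relation.ReflTransGen.refl

theorem Le.sign_eq {T S : CambTree n} (h : T.Le S) : S.1.sign = T.1.sign := by
  induction h with
  | refl => rfl
  | tail _ h ih => rw [h.sign_eq, ih]

theorem Le.desc {T S : CambTree n} (h : T.Le S) {x y : Fin n}
    (hxy : T.1.Desc x y) : S.1.Desc x y := by
  induction h with
  | refl => exact hxy
  | tail _ h ih => exact h.desc ih

theorem Le.eq_or_descCount_lt {T S : CambTree n} (h : T.Le S) :
    T = S ∨ T.descCount < S.descCount := by
  induction h with
  | refl => exact .inl rfl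
  | tail _ h ih => exact .inr (by have := h.descCount_lt; rcases ih with rfl | ih <;> omega)

/-- The increasing rotation of an arc. -/
theorem exists_rotation (T : CambTree n) {i j : Fin n} (h : T.1.arc i j) (hij : i < j) :
    ∃ S : CambTree n, S.1 = T.1.rotate i j ∧ T.IncreasingRotation S :=
  ⟨⟨T.1.rotate i j, (T.isColoring.rotate h hij).isCambrian⟩, rfl, i, j, hij,
    SignedDigraph.rotatesAt_iff.2 ⟨h, rfl⟩⟩

/-- A permutation which is compatible with the decreasing relations of a tree is a linear
extension of a larger tree. -/
theorem exists_le_isLinearExtension (T : CambTree n) (σ : Equiv.Perm (Fin n))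
    (hσ : ∀ x y, T.1.Desc x y → σ.symm x < σ.symm y) :
    ∃ S : CambTree n, T.Le S ∧ S.IsLinearExtension σ := by
  induction hk : n * n - T.descCount using Nat.strong_induction_on generalizing T with
  | _ k ih =>
  by_cases hT : T.IsLinearExtension σ
  · exact ⟨T, .refl T, hT⟩
  unfold IsLinearExtension at hT
  push Not at hT
  obtain ⟨i, j, h, hle⟩ := hT
  have hne := T.isColoring.arc_ne h
  -- A decreasing arc is a decreasing relation, which `σ` respects; so the violated arc is
  -- increasing and can be rotated.
  have hij : i < j := by
    by_contra hlt
    have := hσ i j ⟨.of_arc h, by omega⟩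
    omega
  obtain ⟨S, hS, hTS⟩ := T.exists_rotation h hij
  have hlt : σ.symm j < σ.symm i :=
    lt_of_le_of_ne hle fun e => hne (σ.symm.injective e).symm
  have hbound := S.descCount_le
  obtain ⟨R, hSR, hR⟩ := ih _ (by have := hTS.descCount_lt; omega) S
    (fun x y hxy => T.isColoring.lt_of_desc_rotate h hij hσ hlt (hS ▸ hxy)) rfl
  exact ⟨R, .head hTS hSR, hR⟩

/-- The position in `σ` is a height function common to both trees. -/
theorem IsLinearExtension.unique {T S : CambTree n} {σ : Equiv.Perm (Fin n)}
    (hT : T.IsLinearExtension σ) (hS : S.IsLinearExtension σ) (h : S.1.sign = T.1.sign) :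
    S = T := by
  apply Subtype.ext
  ext u v
  · rw [h]
  · exact ⟨S.isColoring.arc_of_arc T.isColoring h.symm hS hT,
      T.isColoring.arc_of_arc S.isColoring h hT hS⟩

/-- A tree lies below the tree of a permutation if and only if the permutation is compatible
with its decreasing relations. -/
theorem le_iff_of_isLinearExtension {T S : CambTree n} {σ : Equiv.Perm (Fin n)}
    (hS : S.IsLinearExtension σ) (h : S.1.sign = T.1.sign) :
    T.Le S ↔ ∀ x y, T.1.Desc x y → σ.symm x < σ.symm y := by
  constructor
  · exact fun hle x y hxy => (hle.desc hxy).1.lt hS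
  · intro hσ
    obtain ⟨R, hTR, hR⟩ := T.exists_le_isLinearExtension σ hσ
    rwa [hR.unique hS (h.trans hTR.sign_eq.symm)]

/-- Sort the vertices by the number of vertices below them, which grows strictly along arcs. The
label breaks ties, to make the sorting key injective. -/
theorem exists_isLinearExtension (T : CambTree n) :
    ∃ σ : Equiv.Perm (Fin n), T.IsLinearExtension σ := by
  obtain ⟨σ, hσ⟩ := exists_perm_symm_lt_iff
    (f := fun x : Fin n => toLex ({y | T.1.Below y x}.ncard, x))
    (fun x y h => (Prod.mk.inj (toLex.injective h)).2)
  refine ⟨σ, fun u v h => (hσ u v).2 (Prod.Lex.toLex_lt_toLex.2 (.inl ?_))⟩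
  refine Set.ncard_lt_ncard ⟨fun y hy => ?_, fun hsub => ?_⟩ (Set.toFinite _)
  · exact SignedDigraph.Below.trans hy (.of_arc h)
  · exact T.isColoring.below_irrefl u (hsub (a := u) (SignedDigraph.Below.of_arc h))

/-- The opposite Cambrian tree. -/
def op (T : CambTree n) : CambTree n := ⟨T.1.op, T.isColoring.op.isCambrian⟩

theorem op_op (T : CambTree n) : T.op.op = T := Subtype.ext T.1.op_op

theorem IncreasingRotation.op {T S : CambTree n} (h : T.IncreasingRotation S) :
    S.op.IncreasingRotation T.op := by
  obtain ⟨i, j, hij, h, hS⟩ := h.exists_eq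
  refine ⟨i, j, hij, SignedDigraph.rotatesAt_iff.2 ⟨?_, ?_⟩⟩
  · change S.1.arc j i
    rw [hS]
    exact (T.isColoring.rotate_arc i j j i).2 (.inl ⟨rfl, rfl⟩)
  · change T.1.op = S.1.op.rotate i j
    rw [hS, T.isColoring.rotate_op_rotate h hij]

theorem Le.op {T S : CambTree n} (h : T.Le S) : S.op.Le T.op := by
  induction h with
  | refl => exact .refl _
  | tail _ h ih => exact .head h.op ih

theorem op_le_op {T S : CambTree n} : S.op.Le T.op ↔ T.Le S :=
  ⟨fun h => by simpa only [op_op] using h.op, Le.op⟩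

end CambTree

namespace SignedDigraph

variable {n m : ℕ}

/-! ### Extremal leaves -/

/-- The half-turn of a signed digraph: all arcs, all signs and the order of the vertices are
reversed. -/
def halfTurn (T : SignedDigraph n) : SignedDigraph n where
  sign v := !T.sign v.rev
  arc u v := T.arc v.rev u.rev

theorem IsColoring.halfTurn {T : SignedDigraph n} {c : Fin n → Fin n → Ordering}
    (hc : T.IsColoring c) : T.halfTurn.IsColoring fun v u => (c v.rev u.rev).swap where
  conn := by
    have hom : ∃ f : T.graph →g T.halfTurn.graph, ∀ v, f v = v.rev :=
      ⟨⟨Fin.rev, fun {u v} h => by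
        rw [graph_adj] at h ⊢
        simpa [SignedDigraph.halfTurn, or_comm] using h⟩, fun v => rfl⟩
    obtain ⟨f, hf⟩ := hom
    intro u v
    have := (hc.conn u.rev v.rev).map f
    simpa [hf] using this
  adj_eq v u u' h hu hu' := by
    rw [hc.adj_eq v.rev u'.rev u.rev h (by simpa using hu') (by simpa using hu)]
  in_mid v w h := by
    have := hc.out_mid v.rev w.rev h
    simpa [SignedDigraph.halfTurn] using this
  out_mid v w h := by
    have := hc.in_mid v.rev w.rev h
    simpa [SignedDigraph.halfTurn] using this
  inj v w w' h h' he :=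
    Fin.rev_injective (hc.inj v.rev w.rev w'.rev h.symm h'.symm (Ordering.swap_inj.1 he))
  lt_of_lt v u h := by
    have := hc.lt_of_gt v.rev u.rev (by simpa using h)
    simpa using this
  lt_of_gt v u h := by
    have := hc.lt_of_lt v.rev u.rev (by simpa using h)
    simpa using this

/-- The rightmost outgoing leaf, in terms of a colouring. -/
def OutEnd (T : SignedDigraph n) (c : Fin n → Fin n → Ordering) (r : Fin n) : Prop :=
  (∀ w, T.arc r w → T.sign r = true ∧ w < r) ∧ ∀ p, T.sign p = true → c p r ≠ .lt

/-- The leftmost incoming leaf, in terms of a colouring. -/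
def InEnd (T : SignedDigraph n) (c : Fin n → Fin n → Ordering) (l : Fin n) : Prop :=
  (∀ w, T.arc w l → T.sign l = false ∧ l < w) ∧ ∀ p, T.sign p = false → c p l ≠ .gt

/-- The half-turn of the drawing exchanges its top right and bottom left corners, so results on
`InEnd` follow from those on `OutEnd`. -/
theorem inEnd_iff_halfTurn {T : SignedDigraph n} {c : Fin n → Fin n → Ordering} {l : Fin n} :
    T.InEnd c l ↔ T.halfTurn.OutEnd (fun v u => (c v.rev u.rev).swap) l.rev := by
  refine and_congr ⟨fun h w hw => ?_, fun h w hw => ?_⟩ ⟨fun h p hp => ?_, fun h p hp => ?_⟩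
  · have := h w.rev (by simpa [halfTurn] using hw)
    simpa [halfTurn, Fin.lt_rev_iff] using this
  · have := h w.rev (by simpa [halfTurn] using hw)
    simpa [halfTurn] using this
  · have := h p.rev (by simpa [halfTurn] using hp)
    simpa using this
  · have := h p.rev (by simpa [halfTurn] using hp)
    simpa using this

namespace IsColoring

variable {T : SignedDigraph n} {c : Fin n → Fin n → Ordering}

theorem inLeftAncestors_iff (hc : T.IsColoring c) {p u : Fin n} (hp : T.sign p = true) :
    T.InLeftAncestors p u ↔ c p u = .lt := by
  constructor
  · rintro ⟨w, hw, hlt, hb⟩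
    rw [hc.color_branch hb]
    have h1 := hc.out_mid p w hw
    have h2 := hc.lt_of_gt p w
    rcases ordering_cases (c p w) with e | e | e <;> grind
  · intro h
    have hne : u ≠ p := by
      rintro rfl
      have := hc.color_self u
      grind
    obtain ⟨w, hw, hcw, hb⟩ := hc.exists_toward hne
    have h1 := hc.in_mid p w
    have h2 := hc.lt_of_lt p w
    exact ⟨w, by grind, by grind, hb⟩

theorem inRightDescendants_iff (hc : T.IsColoring c) {p u : Fin n} (hp : T.sign p = false) :
    T.InRightDescendants p u ↔ c p u = .gt := by
  constructor
  · rintro ⟨w, hw, hlt, hb⟩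
    rw [hc.color_branch hb]
    have h1 := hc.in_mid p w hw
    have h2 := hc.lt_of_lt p w
    rcases ordering_cases (c p w) with e | e | e <;> grind
  · intro h
    have hne : u ≠ p := by
      rintro rfl
      have := hc.color_self u
      grind
    obtain ⟨w, hw, hcw, hb⟩ := hc.exists_toward hne
    have h1 := hc.out_mid p w
    have h2 := hc.lt_of_gt p w
    exact ⟨w, by grind, by grind, hb⟩

theorem rightmostOutLeafAt_iff (hc : T.IsColoring c) {r : Fin n} :
    T.RightmostOutLeafAt r ↔ T.OutEnd c r :=
  and_congr_right fun _ => forall₂_congr fun _ hp => not_congr (hc.inLeftAncestors_iff hp)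

theorem leftmostInLeafAt_iff (hc : T.IsColoring c) {l : Fin n} :
    T.LeftmostInLeafAt l ↔ T.InEnd c l :=
  and_congr_right fun _ => forall₂_congr fun _ hp => not_congr (hc.inRightDescendants_iff hp)

/-- Among the vertices in no left ancestor subtree (the largest label is one) take a maximal one for
`Below`. Each of its parents is in a left ancestor subtree, necessarily of this vertex itself. -/
theorem exists_outEnd (hc : T.IsColoring c) (hn : 0 < n) : ∃ r, T.OutEnd c r := by
  obtain ⟨r, hr, hmax⟩ := hc.op.below_wf.has_min
    {v | ∀ p, T.sign p = true → c p v ≠ .lt} ⟨⟨n - 1, by omega⟩, fun p _ h => by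
      have := hc.lt_of_lt _ _ h
      have := p.2
      simp only [Fin.lt_def] at *
      omega⟩
  refine ⟨r, fun w hw => ?_, hr⟩
  have hwG : ¬ ∀ p, T.sign p = true → c p w ≠ .lt :=
    fun hG => hmax w hG (op_below.2 (.of_arc hw))
  push Not at hwG
  obtain ⟨p, hp, hcp⟩ := hwG
  have h1 := hr p hp
  have h2 := hc.adj_eq p r w hw
  have h3 := hc.color_self w
  have h4 := hc.lt_of_lt p w hcp
  by_cases hpr : p = r
  · subst hpr
    exact ⟨hp, h4⟩
  · grind

/-- The neighbour of the end vertex towards a larger vertex is a child. -/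
theorem OutEnd.exists_child (hc : T.IsColoring c) {r v : Fin n} (hr : T.OutEnd c r)
    (hv : r < v) : ∃ a, T.arc a r ∧ c r a = c r v := by
  obtain ⟨a, ha, hca, -⟩ := hc.exists_toward hv.ne'
  rcases ha with ha | ha
  · exfalso
    obtain ⟨hs, hlt⟩ := hr.1 a ha
    have h1 := hc.out_mid r a ha
    have h2 := hc.lt_of_gt r a
    have h3 := hc.lt_of_lt r v
    rcases ordering_cases (c r a) with e | e | e <;> grind
  · exact ⟨a, ha, hca⟩

/-- The case of a negative `v` remains. The path from `r` to `v > r` starts downwards. If it is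
directed, `r` is an ancestor of `v`, not in a left descendant subtree. If it has a valley `t`, then
`r` is not on the left of `t`, so `v < t < r`, a contradiction. -/
theorem OutEnd.color_ne_lt (hc : T.IsColoring c) {r : Fin n} (hr : T.OutEnd c r) (v : Fin n) :
    c v r ≠ .lt := by
  intro h
  have hrv := hc.lt_of_lt v r h
  have hs : T.sign v = false := by
    have := hr.2 v
    grind
  obtain ⟨a, ha, hca⟩ := OutEnd.exists_child hc hr hrv
  rcases hc.below_or_valley hrv.ne' ha hca with h1 | ⟨t, ht, -, h1, h2, h3⟩
  · obtain ⟨-, w, hw, hcw⟩ := hc.below_toward h1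
    have := hc.out_mid v w hw
    grind
  · have h4 := hr.2 t ht
    have h5 := hc.lt_of_gt t r
    have h6 := hc.lt_of_lt t v
    rcases ordering_cases (c t r) with e | e | e <;>
      rcases ordering_cases (c t v) with e' | e' | e' <;> grind

/-- If `r < r'`, the path from `r` to `r'` starts downwards. At a valley, one of the two would be in
a left ancestor subtree. If it is directed, `r'` has a parent towards `r`, which must be a left one,
and puts `r` in a left ancestor subtree. -/
theorem OutEnd.le (hc : T.IsColoring c) {r r' : Fin n} (hr : T.OutEnd c r)
    (hr' : T.OutEnd c r') : r' ≤ r := by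
  by_contra hlt
  rw [not_le] at hlt
  obtain ⟨a, ha, hca⟩ := OutEnd.exists_child hc hr hlt
  rcases hc.below_or_valley hlt.ne' ha hca with h1 | ⟨t, ht, -, h1, h2, h3⟩
  · obtain ⟨-, w, hw, hcw⟩ := hc.below_toward h1
    obtain ⟨hs, hw'⟩ := hr'.1 w hw
    have h5 := hc.out_mid r' w hw
    have h6 := hc.lt_of_gt r' w
    have h7 := hc.color_self r'
    have h8 := OutEnd.color_ne_lt hc hr r'
    rcases ordering_cases (c r' w) with e | e | e <;> grind
  · have h4 := hr.2 t ht
    have h5 := hr'.2 t ht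
    rcases ordering_cases (c t r) with e | e | e <;>
      rcases ordering_cases (c t r') with e' | e' | e' <;> grind

theorem OutEnd.unique (hc : T.IsColoring c) {r r' : Fin n} (hr : T.OutEnd c r)
    (hr' : T.OutEnd c r') : r = r' :=
  le_antisymm (OutEnd.le hc hr' hr) (OutEnd.le hc hr hr')

theorem exists_inEnd (hc : T.IsColoring c) (hn : 0 < n) : ∃ l, T.InEnd c l := by
  obtain ⟨r, hr⟩ := hc.halfTurn.exists_outEnd hn
  exact ⟨r.rev, inEnd_iff_halfTurn.2 (by simpa using hr)⟩

theorem InEnd.unique (hc : T.IsColoring c) {l l' : Fin n} (hl : T.InEnd c l)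
    (hl' : T.InEnd c l') : l = l' :=
  Fin.rev_injective
    (OutEnd.unique hc.halfTurn (inEnd_iff_halfTurn.1 hl) (inEnd_iff_halfTurn.1 hl'))

theorem InEnd.color_ne_gt (hc : T.IsColoring c) {l : Fin n} (hl : T.InEnd c l) (v : Fin n) :
    c v l ≠ .gt := by
  have := OutEnd.color_ne_lt hc.halfTurn (inEnd_iff_halfTurn.1 hl) v.rev
  simpa using this

/-- The colours, at the vertices of a tree, of a tree that is grafted on its rightmost outgoing
leaf. -/
theorem exists_outColor (hc : T.IsColoring c) : ∃ f : Fin n → Ordering, (∀ v, f v ≠ .lt) ∧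
    ∀ r, T.OutEnd c r → (∀ v, v ≠ r → f v = c v r) ∧ (f r = .eq ↔ T.sign r = false) ∧
      ∀ w, T.arc r w ∨ T.arc w r → c r w ≠ f r := by
  by_cases h : ∃ r, T.OutEnd c r
  · obtain ⟨r, hr⟩ := h
    -- The grafted tree is seen from `v ≠ r` in the direction of `r`, and from `r` in its empty
    -- parent slot.
    refine ⟨fun v => if v = r then (if T.sign r = true then .gt else .eq) else c v r,
      fun v => ?_, fun r' hr' => ?_⟩
    · have := OutEnd.color_ne_lt hc hr v
      grind
    · obtain rfl := OutEnd.unique hc hr hr'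
      refine ⟨by grind, by grind, fun w hw => ?_⟩
      have h1 := hr.1 w
      have h2 := hc.in_mid r w
      have h3 := hc.out_mid r w
      have h4 := hc.lt_of_gt r w
      grind
  · exact ⟨fun _ => .eq, by simp, fun r hr => absurd ⟨r, hr⟩ h⟩

/-- The colours, at the vertices of a tree, of a tree that is grafted on its leftmost incoming
leaf. -/
theorem exists_inColor (hc : T.IsColoring c) : ∃ f : Fin n → Ordering, (∀ v, f v ≠ .gt) ∧
    ∀ l, T.InEnd c l → (∀ v, v ≠ l → f v = c v l) ∧ (f l = .eq ↔ T.sign l = true) ∧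
      ∀ w, T.arc l w ∨ T.arc w l → c l w ≠ f l := by
  by_cases h : ∃ l, T.InEnd c l
  · obtain ⟨l, hl⟩ := h
    refine ⟨fun v => if v = l then (if T.sign l = true then .eq else .lt) else c v l,
      fun v => ?_, fun l' hl' => ?_⟩
    · have := InEnd.color_ne_gt hc hl v
      grind
    · obtain rfl := InEnd.unique hc hl hl'
      refine ⟨by grind, by grind, fun w hw => ?_⟩
      have h1 := hl.1 w
      have h2 := hc.in_mid l w
      have h3 := hc.out_mid l w
      have h4 := hc.lt_of_lt l w
      grind
  · exact ⟨fun _ => .eq, by simp, fun l hl => absurd ⟨l, hl⟩ h⟩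

end IsColoring

/-! ### Grafting -/

section Graft

theorem castAdd_ne_natAdd (u : Fin n) (v : Fin m) : Fin.castAdd m u ≠ Fin.natAdd n v := by
  intro h
  have := congrArg Fin.val h
  simp only [Fin.val_castAdd, Fin.val_natAdd] at this
  omega

theorem castAdd_lt_natAdd (u : Fin n) (v : Fin m) : Fin.castAdd m u < Fin.natAdd n v := by
  simp only [Fin.lt_def, Fin.val_castAdd, Fin.val_natAdd]
  omega

theorem castAdd_lt_iff {u v : Fin n} : Fin.castAdd m u < Fin.castAdd m v ↔ u < v := Iff.rfl

theorem natAdd_lt_iff {u v : Fin m} : Fin.natAdd n u < Fin.natAdd n v ↔ u < v := by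
  simp only [Fin.lt_def, Fin.val_natAdd]
  omega

section Arcs

variable (T : SignedDigraph n) (T' : SignedDigraph m)

theorem graftNE_sign_left (u : Fin n) : (T.graftNE T').sign (Fin.castAdd m u) = T.sign u := by
  simp [graftNE]

theorem graftNE_sign_right (u : Fin m) : (T.graftNE T').sign (Fin.natAdd n u) = T'.sign u := by
  simp [graftNE]

theorem graftNE_arc_left (u v : Fin n) :
    (T.graftNE T').arc (Fin.castAdd m u) (Fin.castAdd m v) ↔ T.arc u v := by
  simp [graftNE, castAdd_ne_natAdd]

theorem graftNE_arc_right (u v : Fin m) :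
    (T.graftNE T').arc (Fin.natAdd n u) (Fin.natAdd n v) ↔ T'.arc u v := by
  simp [graftNE, (castAdd_ne_natAdd _ _).symm]

theorem graftNE_arc_left_right (u : Fin n) (v : Fin m) :
    (T.graftNE T').arc (Fin.castAdd m u) (Fin.natAdd n v) ↔
      T.RightmostOutLeafAt u ∧ T'.LeftmostInLeafAt v := by
  simp [graftNE, castAdd_ne_natAdd, (castAdd_ne_natAdd _ _).symm]

theorem graftNE_arc_right_left (u : Fin n) (v : Fin m) :
    (T.graftNE T').arc (Fin.natAdd n v) (Fin.castAdd m u) ↔ False := by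
  simp [graftNE, castAdd_ne_natAdd, (castAdd_ne_natAdd _ _).symm]

end Arcs

/-- The colouring of a grafted tree. -/
def graftColor (c : Fin n → Fin n → Ordering) (f : Fin n → Ordering)
    (c' : Fin m → Fin m → Ordering) (g : Fin m → Ordering) (x y : Fin (n + m)) : Ordering :=
  Fin.addCases (fun v => Fin.addCases (c v) (fun _ => f v) y)
    (fun v => Fin.addCases (fun _ => g v) (c' v) y) x

variable {T : SignedDigraph n} {T' : SignedDigraph m} {c : Fin n → Fin n → Ordering}
  {c' : Fin m → Fin m → Ordering}

theorem graftNE_conn (hc : T.IsColoring c) (hc' : T'.IsColoring c') :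
    (T.graftNE T').graph.Preconnected := by
  have hl : ∀ u v, (T.graftNE T').graph.Reachable (Fin.castAdd m u) (Fin.castAdd m v) :=
    fun u v => (hc.conn u v).map ⟨Fin.castAdd m, fun {u v} h => by
      rw [graph_adj] at h ⊢
      simpa [graftNE_arc_left] using h⟩
  have hr : ∀ u v, (T.graftNE T').graph.Reachable (Fin.natAdd n u) (Fin.natAdd n v) :=
    fun u v => (hc'.conn u v).map ⟨Fin.natAdd n, fun {u v} h => by
      rw [graph_adj] at h ⊢
      simpa [graftNE_arc_right] using h⟩
  have hlr : ∀ u v, (T.graftNE T').graph.Reachable (Fin.castAdd m u) (Fin.natAdd n v) := by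
    intro u v
    obtain ⟨r, hr'⟩ := hc.exists_outEnd u.pos
    obtain ⟨l, hl'⟩ := hc'.exists_inEnd v.pos
    have hadj : (T.graftNE T').graph.Adj (Fin.castAdd m r) (Fin.natAdd n l) :=
      (graph_adj _).2 ⟨castAdd_ne_natAdd _ _, .inl ((graftNE_arc_left_right _ _ _ _).2
        ⟨hc.rightmostOutLeafAt_iff.2 hr', hc'.leftmostInLeafAt_iff.2 hl'⟩)⟩
    exact (hl u r).trans (hadj.reachable.trans (hr l v))
  intro x y
  induction x using Fin.addCases with
  | left x =>
    induction y using Fin.addCases with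
    | left y => exact hl x y
    | right y => exact hlr x y
  | right x =>
    induction y using Fin.addCases with
    | left y => exact (hlr y x).symm
    | right y => exact hr x y

/-- Each vertex keeps its colouring of its own tree and gives the whole other tree one colour, that
of the grafting direction. As all labels of `T'` are larger, the order conditions amount to `f`
never being `.lt` and `g` never being `.gt`. -/
theorem exists_isColoring_graftNE (hc : T.IsColoring c) (hc' : T'.IsColoring c') :
    ∃ d, (T.graftNE T').IsColoring d := by
  obtain ⟨f, hf, hf'⟩ := hc.exists_outColor
  obtain ⟨g, hg, hg'⟩ := hc'.exists_inColor
  refine ⟨graftColor c f c' g, graftNE_conn hc hc', ?_, ?_, ?_, ?_, ?_, ?_⟩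
  · intro v u u' h hu hu'
    induction v using Fin.addCases <;> induction u using Fin.addCases <;>
      induction u' using Fin.addCases <;>
      simp only [graftColor, Fin.addCases_left, Fin.addCases_right, graftNE_arc_left,
        graftNE_arc_right, graftNE_arc_left_right, graftNE_arc_right_left,
        hc.rightmostOutLeafAt_iff, hc'.leftmostInLeafAt_iff, ne_eq, Fin.castAdd_inj,
        Fin.natAdd_inj] at *
    · exact hc.adj_eq _ _ _ h hu hu'
    · exact ((hf' _ h.1).1 _ (Ne.symm hu)).symm
    · exact (hg' _ h.2).1 _ (Ne.symm hu')
    · exact hc'.adj_eq _ _ _ h hu hu'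
  · intro v u h
    induction v using Fin.addCases <;> induction u using Fin.addCases <;>
      simp only [graftColor, Fin.addCases_left, Fin.addCases_right, graftNE_arc_left,
        graftNE_arc_right, graftNE_arc_left_right, graftNE_arc_right_left,
        hc.rightmostOutLeafAt_iff, hc'.leftmostInLeafAt_iff, graftNE_sign_left,
        graftNE_sign_right] at *
    · exact hc.in_mid _ _ h
    · exact (hg' _ h.2).2.1
    · exact hc'.in_mid _ _ h
  · intro v u h
    induction v using Fin.addCases <;> induction u using Fin.addCases <;>
      simp only [graftColor, Fin.addCases_left, Fin.addCases_right, graftNE_arc_left,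
        graftNE_arc_right, graftNE_arc_left_right, graftNE_arc_right_left,
        hc.rightmostOutLeafAt_iff, hc'.leftmostInLeafAt_iff, graftNE_sign_left,
        graftNE_sign_right] at *
    · exact hc.out_mid _ _ h
    · exact (hf' _ h.1).2.1
    · exact hc'.out_mid _ _ h
  · intro v w w' h h' he
    induction v using Fin.addCases <;> induction w using Fin.addCases <;>
      induction w' using Fin.addCases <;>
      simp only [graftColor, Fin.addCases_left, Fin.addCases_right, graftNE_arc_left,
        graftNE_arc_right, graftNE_arc_left_right, graftNE_arc_right_left,
        hc.rightmostOutLeafAt_iff, hc'.leftmostInLeafAt_iff, Fin.castAdd_inj,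
        Fin.natAdd_inj, or_false, false_or] at *
    · exact hc.inj _ _ _ h h' he
    · exact absurd he ((hf' _ h'.1).2.2 _ h)
    · exact absurd he.symm ((hf' _ h.1).2.2 _ h')
    · exact IsColoring.InEnd.unique hc' h.2 h'.2
    · exact IsColoring.OutEnd.unique hc h.1 h'.1
    · exact absurd he.symm ((hg' _ h.2).2.2 _ h')
    · exact absurd he ((hg' _ h'.2).2.2 _ h)
    · exact hc'.inj _ _ _ h h' he
  · intro v u h
    induction v using Fin.addCases <;> induction u using Fin.addCases <;>
      simp only [graftColor, Fin.addCases_left, Fin.addCases_right] at h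
    · exact castAdd_lt_iff.2 (hc.lt_of_lt _ _ h)
    · exact absurd h (hf _)
    · exact castAdd_lt_natAdd _ _
    · exact natAdd_lt_iff.2 (hc'.lt_of_lt _ _ h)
  · intro v u h
    induction v using Fin.addCases <;> induction u using Fin.addCases <;>
      simp only [graftColor, Fin.addCases_left, Fin.addCases_right] at h
    · exact castAdd_lt_iff.2 (hc.lt_of_gt _ _ h)
    · exact castAdd_lt_natAdd _ _
    · exact absurd h (hg _)
    · exact natAdd_lt_iff.2 (hc'.lt_of_gt _ _ h)

/-- The order of a grafted tree. -/
theorem below_graftNE {x y : Fin (n + m)} (h : (T.graftNE T').Below x y) :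
    (∃ u v, x = Fin.castAdd m u ∧ y = Fin.castAdd m v ∧ T.Below u v) ∨
    (∃ u v, x = Fin.natAdd n u ∧ y = Fin.natAdd n v ∧ T'.Below u v) ∨
    (∃ u v, x = Fin.castAdd m u ∧ y = Fin.natAdd n v) := by
  induction h with
  | single h =>
    rcases h with ⟨u, v, rfl, rfl, h⟩ | ⟨u, v, rfl, rfl, h⟩ | ⟨u, v, rfl, rfl, h⟩
    · exact .inl ⟨u, v, rfl, rfl, .of_arc h⟩
    · exact .inr (.inl ⟨u, v, rfl, rfl, .of_arc h⟩)
    · exact .inr (.inr ⟨u, v, rfl, rfl⟩)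
  | tail _ h ih =>
    rcases ih with ⟨u, v, rfl, rfl, hb⟩ | ⟨u, v, rfl, rfl, hb⟩ | ⟨u, v, rfl, rfl⟩ <;>
      rcases h with ⟨u', v', h1, rfl, h⟩ | ⟨u', v', h1, rfl, h⟩ | ⟨u', v', h1, rfl, h⟩
    · obtain rfl := Fin.castAdd_injective _ _ h1
      exact .inl ⟨u, v', rfl, rfl, hb.trans (.of_arc h)⟩
    · exact absurd h1 (castAdd_ne_natAdd _ _)
    · exact .inr (.inr ⟨u, v', rfl, rfl⟩)
    · exact absurd h1.symm (castAdd_ne_natAdd _ _)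
    · obtain rfl := Fin.natAdd_injective _ _ h1
      exact .inr (.inl ⟨u, v', rfl, rfl, hb.trans (.of_arc h)⟩)
    · exact absurd h1.symm (castAdd_ne_natAdd _ _)
    · exact absurd h1.symm (castAdd_ne_natAdd _ _)
    · exact .inr (.inr ⟨u, v', rfl, rfl⟩)
    · exact absurd h1.symm (castAdd_ne_natAdd _ _)

/-- The decreasing relations of a grafted tree are those of the two trees. -/
theorem forall_desc_graftNE {p : Fin (n + m) → Fin (n + m) → Prop} :
    (∀ x y, (T.graftNE T').Desc x y → p x y) ↔
      (∀ u v, T.Desc u v → p (Fin.castAdd m u) (Fin.castAdd m v)) ∧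
        ∀ u v, T'.Desc u v → p (Fin.natAdd n u) (Fin.natAdd n v) := by
  constructor
  · intro h
    refine ⟨fun u v huv => h _ _ ⟨?_, castAdd_lt_iff.2 huv.2⟩,
      fun u v huv => h _ _ ⟨?_, natAdd_lt_iff.2 huv.2⟩⟩
    · exact huv.1.lift (Fin.castAdd m) fun a b hab => (graftNE_arc_left T T' a b).2 hab
    · exact huv.1.lift (Fin.natAdd n) fun a b hab => (graftNE_arc_right T T' a b).2 hab
  · rintro ⟨h1, h2⟩ x y ⟨hb, hlt⟩
    rcases below_graftNE hb with ⟨u, v, rfl, rfl, hb'⟩ | ⟨u, v, rfl, rfl, hb'⟩ | ⟨u, v, rfl, rfl⟩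
    · exact h1 u v ⟨hb', castAdd_lt_iff.1 hlt⟩
    · exact h2 u v ⟨hb', natAdd_lt_iff.1 hlt⟩
    -- Relations that cross the graft are increasing.
    · exact absurd hlt (castAdd_lt_natAdd u v).asymm

/-- Duality swaps incoming and outgoing leaves and keeps left and right. -/
theorem graftNW_eq (T : SignedDigraph n) (T' : SignedDigraph m) :
    T.graftNW T' = (T.op.graftNE T'.op).op := by
  have hbr : ∀ {k : ℕ} (S : SignedDigraph k) v w u, S.op.Branch v w u ↔ S.Branch v w u := by
    intro k S v w u
    simp only [Branch]
    rw [op_graph]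
  have h1 : ∀ u, T.op.RightmostOutLeafAt u ↔ T.RightmostInLeafAt u := by
    intro u
    simp [RightmostOutLeafAt, RightmostInLeafAt, InLeftAncestors, InLeftDescendants, hbr,
      op_sign, op_arc]
  have h2 : ∀ u, T'.op.LeftmostInLeafAt u ↔ T'.LeftmostOutLeafAt u := by
    intro u
    simp [LeftmostInLeafAt, LeftmostOutLeafAt, InRightAncestors, InRightDescendants, hbr,
      op_sign, op_arc]
  ext x y
  · rw [op_sign]
    induction x using Fin.addCases <;> simp [graftNW, graftNE, op_sign]
  · rw [op_arc]
    simp only [graftNW, graftNE, h1, h2, op_arc]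
    constructor
    · rintro (⟨u, v, h⟩ | ⟨u, v, h⟩ | ⟨u, v, h⟩)
      · exact .inl ⟨v, u, by tauto⟩
      · exact .inr (.inl ⟨v, u, by tauto⟩)
      · exact .inr (.inr ⟨u, v, by tauto⟩)
    · rintro (⟨u, v, h⟩ | ⟨u, v, h⟩ | ⟨u, v, h⟩)
      · exact .inl ⟨v, u, by tauto⟩
      · exact .inr (.inl ⟨v, u, by tauto⟩)
      · exact .inr (.inr ⟨u, v, by tauto⟩)

end Graft

end SignedDigraph

/-! ### Shifted shuffles by relative order -/

theorem mem_shiftedShuffle {n m : ℕ} {σ : Equiv.Perm (Fin n)} {τ : Equiv.Perm (Fin m)}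
    {ρ : Equiv.Perm (Fin (n + m))} : ρ ∈ shiftedShuffle σ τ ↔
      (∀ u v, ρ.symm (Fin.castAdd m u) < ρ.symm (Fin.castAdd m v) ↔ σ.symm u < σ.symm v) ∧
        ∀ u v, ρ.symm (Fin.natAdd n u) < ρ.symm (Fin.natAdd n v) ↔ τ.symm u < τ.symm v := by
  have hl : ∀ a, shiftedConcat σ τ (Fin.castAdd m a) = Fin.castAdd m (σ a) := fun a => by
    simp [shiftedConcat]
  have hr : ∀ a, shiftedConcat σ τ (Fin.natAdd n a) = Fin.natAdd n (τ a) := fun a => by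
    simp [shiftedConcat]
  simp only [shiftedShuffle, Finset.mem_image, Finset.mem_filter, Finset.mem_univ, true_and]
  have key : ∀ {k : ℕ} (f : Fin k → Fin (n + m)) (α : Equiv.Perm (Fin k)),
      StrictMono (fun a => f (α a)) ↔ ∀ u v, f u < f v ↔ α.symm u < α.symm v := by
    intro k f α
    constructor
    · intro h u v
      rw [← h.lt_iff_lt]
      simp
    · intro h a b hab
      rw [h]
      simpa using hab
  constructor
  · rintro ⟨π, ⟨h1, h2⟩, rfl⟩
    have hs : ∀ x, π x = (shiftedConcat σ τ * π⁻¹).symm (shiftedConcat σ τ x) := by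
      intro x
      rw [Equiv.eq_symm_apply]
      simp
    rw [← key (fun u => (shiftedConcat σ τ * π⁻¹).symm (Fin.castAdd m u)) σ,
      ← key (fun u => (shiftedConcat σ τ * π⁻¹).symm (Fin.natAdd n u)) τ]
    simp only [hs, hl, hr] at h1 h2
    exact ⟨h1, h2⟩
  · rintro ⟨h1, h2⟩
    -- The only solution `π` of `shiftedConcat σ τ * π⁻¹ = ρ`.
    refine ⟨ρ⁻¹ * shiftedConcat σ τ, ⟨?_, ?_⟩, by simp⟩
    · simp only [Equiv.Perm.mul_apply, hl]
      exact (key (fun u => ρ.symm (Fin.castAdd m u)) σ).2 h1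
    · simp only [Equiv.Perm.mul_apply, hr]
      exact (key (fun u => ρ.symm (Fin.natAdd n u)) τ).2 h2

/-- The identity is the only order automorphism of `Fin n`. -/
theorem perm_eq_of_symm_lt_iff {n : ℕ} {σ σ' : Equiv.Perm (Fin n)}
    (h : ∀ u v, σ.symm u < σ.symm v ↔ σ'.symm u < σ'.symm v) : σ = σ' := by
  have hm : StrictMono (σ'.trans σ.symm) := fun a b hab => (h _ _).2 (by simpa using hab)
  have := congrFun (Subsingleton.elim (hm.orderIsoOfSurjective _ (σ'.trans σ.symm).surjective)
    (OrderIso.refl _) |> congrArg DFunLike.coe)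
  ext a
  have h1 := this a
  simp only [StrictMono.coe_orderIsoOfSurjective, Equiv.trans_apply, OrderIso.refl_apply,
    Equiv.symm_apply_eq] at h1
  rw [h1]

/-- Every permutation belongs to exactly one shifted shuffle. -/
theorem existsUnique_mem_shiftedShuffle {n m : ℕ} (ρ : Equiv.Perm (Fin (n + m))) :
    ∃! p : Equiv.Perm (Fin n) × Equiv.Perm (Fin m), ρ ∈ shiftedShuffle p.1 p.2 := by
  obtain ⟨σ, hσ⟩ := exists_perm_symm_lt_iff (f := fun u => ρ.symm (Fin.castAdd m u))
    (ρ.symm.injective.comp (Fin.castAdd_injective n m))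
  obtain ⟨τ, hτ⟩ := exists_perm_symm_lt_iff (f := fun u => ρ.symm (Fin.natAdd n u))
    (ρ.symm.injective.comp (Fin.natAdd_injective m n))
  refine ⟨(σ, τ), mem_shiftedShuffle.2 ⟨fun u v => (hσ u v).symm, fun u v => (hτ u v).symm⟩, ?_⟩
  rintro ⟨σ', τ'⟩ h
  obtain ⟨h1, h2⟩ := mem_shiftedShuffle.1 h
  exact Prod.ext (perm_eq_of_symm_lt_iff fun u v => (h1 u v).symm.trans (hσ u v).symm)
    (perm_eq_of_symm_lt_iff fun u v => (h2 u v).symm.trans (hτ u v).symm)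

/-! ### Expansions in the basis `F` and products -/

section Algebra

variable (𝕜 : Type*) [Field 𝕜]

open scoped Classical in
/-- The product of the sums over two sets of permutations. -/
theorem sum_F_mul_sum_F {n m : ℕ} {D : Equiv.Perm (Fin n) → Prop} {D' : Equiv.Perm (Fin m) → Prop}
    {D'' : Equiv.Perm (Fin (n + m)) → Prop}
    [DecidablePred D] [DecidablePred D'] [DecidablePred D''] (s : Fin n → Bool) (s' : Fin m → Bool)
    (h : ∀ σ τ ρ, ρ ∈ shiftedShuffle σ τ → (D'' ρ ↔ D σ ∧ D' τ)) :
    (∑ σ with D σ, F 𝕜 ⟨n, σ, s⟩) * (∑ τ with D' τ, F 𝕜 ⟨m, τ, s'⟩) =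
      ∑ ρ with D'' ρ, F 𝕜 ⟨n + m, ρ, Fin.append s s'⟩ := by
  change FQSym.mulMap 𝕜 _ _ = _
  simp only [map_sum, LinearMap.sum_apply]
  have hF : ∀ σ τ, FQSym.mulMap 𝕜 (F 𝕜 σ) (F 𝕜 τ) = shuffleSum 𝕜 σ τ := F_mul_F 𝕜
  simp only [hF, shuffleSum]
  rw [← Finset.sum_product', Finset.sum_comm' (t' := {ρ | D'' ρ})
    (s' := fun ρ => Finset.univ.filter fun p : Equiv.Perm (Fin m) × Equiv.Perm (Fin n) =>
      ρ ∈ shiftedShuffle p.2 p.1)]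
  · refine Finset.sum_congr rfl fun ρ _ => ?_
    obtain ⟨⟨σ, τ⟩, hp, hu⟩ := existsUnique_mem_shiftedShuffle ρ
    have : (Finset.univ.filter fun p : Equiv.Perm (Fin m) × Equiv.Perm (Fin n) =>
        ρ ∈ shiftedShuffle p.2 p.1) = {(τ, σ)} := by
      ext ⟨τ', σ'⟩
      simp only [Finset.mem_filter, Finset.mem_univ, true_and, Finset.mem_singleton]
      constructor
      · intro h'
        have := hu (σ', τ') h'
        simp_all
      · intro h'
        obtain ⟨rfl, rfl⟩ := Prod.mk.inj h'
        exact hp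
    rw [this, Finset.sum_singleton]
  · rintro ⟨τ, σ⟩ ρ
    have := h σ τ ρ
    simp only [Finset.mem_product, Finset.mem_filter, Finset.mem_univ, true_and]
    tauto

open scoped Classical in
/-- The sum of `P` over a set of trees with the same signs. -/
theorem sum_P_eq {n : ℕ} {Q : CambTree n → Prop} {D : Equiv.Perm (Fin n) → Prop}
    {s : Fin n → Bool} [DecidablePred Q] [DecidablePred D] (hs : ∀ S, Q S → S.1.sign = s)
    (hD : ∀ σ, D σ ↔ ∃ S, Q S ∧ S.IsLinearExtension σ) :
    ∑ S : CambTree n with Q S, P 𝕜 S = ∑ σ with D σ, F 𝕜 ⟨n, σ, s⟩ := by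
  have h1 : ∑ S : CambTree n with Q S, P 𝕜 S =
      ∑ S : CambTree n with Q S, ∑ σ : Equiv.Perm (Fin n) with S.IsLinearExtension σ,
        F 𝕜 ⟨n, σ, s⟩ := by
    refine Finset.sum_congr rfl fun S hS => ?_
    rw [P, hs S (Finset.mem_filter.1 hS).2]
  rw [h1, Finset.sum_comm' (t' := {σ | D σ})
    (s' := fun σ => Finset.univ.filter fun S : CambTree n => Q S ∧ S.IsLinearExtension σ)]
  · refine Finset.sum_congr rfl fun σ hσ => ?_
    obtain ⟨S, hS, hSσ⟩ := (hD σ).1 (Finset.mem_filter.1 hσ).2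
    have : (Finset.univ.filter fun S : CambTree n => Q S ∧ S.IsLinearExtension σ) = {S} := by
      ext R
      simp only [Finset.mem_filter, Finset.mem_univ, true_and, Finset.mem_singleton]
      constructor
      · exact fun hR => hSσ.unique hR.2 ((hs R hR.1).trans (hs S hS).symm)
      · rintro rfl
        exact ⟨hS, hSσ⟩
    rw [this, Finset.sum_singleton]
  · intro S σ
    have := hD σ
    simp only [Finset.mem_filter, Finset.mem_univ, true_and]
    constructor
    · exact fun h => ⟨h, this.2 ⟨S, h⟩⟩
    · exact fun h => h.1

-- The sets of linear extensions of the trees above `T` are disjoint, and their union is given by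
-- `exists_le_isLinearExtension` and `le_iff_of_isLinearExtension`.
open scoped Classical in
theorem E_eq {n : ℕ} (T : CambTree n) : E 𝕜 T =
    ∑ σ : Equiv.Perm (Fin n) with (∀ x y, T.1.Desc x y → σ.symm x < σ.symm y),
      F 𝕜 ⟨n, σ, T.1.sign⟩ := by
  unfold E
  refine sum_P_eq 𝕜 (Q := fun S => T.Le S) (fun S h => h.sign_eq) fun σ => ⟨T.exists_le_isLinearExtension σ, ?_⟩
  rintro ⟨S, hS, hσ⟩
  exact (CambTree.le_iff_of_isLinearExtension hσ hS.sign_eq).1 hS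

-- The argument for `E`, applied to the opposite tree and to the words read backwards.
open scoped Classical in
theorem H_eq {n : ℕ} (T : CambTree n) : H 𝕜 T =
    ∑ σ : Equiv.Perm (Fin n) with (∀ x y, T.1.op.Desc x y → σ.symm y < σ.symm x),
      F 𝕜 ⟨n, σ, T.1.sign⟩ := by
  unfold H
  refine sum_P_eq 𝕜 (Q := fun S => S.Le T) (fun S h => h.sign_eq.symm) fun σ => ?_
  -- `Fin.revPerm.trans σ` is the word of `σ` read from right to left.
  have hrev : ∀ x, (Fin.revPerm.trans σ).symm x = (σ.symm x).rev := fun x => rfl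
  have hop : ∀ S : CambTree n,
      S.op.IsLinearExtension (Fin.revPerm.trans σ) ↔ S.IsLinearExtension σ := by
    intro S
    simp only [CambTree.IsLinearExtension, hrev, Fin.rev_lt_rev]
    exact forall_comm
  constructor
  · intro h
    obtain ⟨S, hS, hσ⟩ := T.op.exists_le_isLinearExtension (Fin.revPerm.trans σ)
      fun x y hxy => by simpa only [hrev, Fin.rev_lt_rev] using h x y hxy
    refine ⟨S.op, ?_, ?_⟩
    · rw [← CambTree.op_le_op, CambTree.op_op]
      exact hS
    · rw [← hop, CambTree.op_op]
      exact hσ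
  · rintro ⟨S, hS, hσ⟩ x y hxy
    have := (CambTree.le_iff_of_isLinearExtension ((hop S).2 hσ) hS.op.sign_eq).1 hS.op x y hxy
    simpa only [hrev, Fin.rev_lt_rev] using this

theorem isCambrian_graftNE {n m : ℕ} (T : CambTree n) (T' : CambTree m) :
    (T.1.graftNE T'.1).IsCambrian :=
  (SignedDigraph.exists_isColoring_graftNE T.isColoring T'.isColoring).elim
    fun _ h => h.isCambrian

theorem isCambrian_graftNW {n m : ℕ} (T : CambTree n) (T' : CambTree m) :
    (T.1.graftNW T'.1).IsCambrian := by
  rw [SignedDigraph.graftNW_eq]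
  exact (SignedDigraph.exists_isColoring_graftNE T.op.isColoring T'.op.isColoring).elim
    fun _ h => h.op.isCambrian

/-- A shuffle `ρ` of `σ` and `τ` orders small values as `σ` does and large ones as `τ` does. So it
respects the decreasing relations of the graft exactly when `σ` and `τ` respect those of `T` and
`T'`. -/
theorem E_mul_E {n m : ℕ} (T : CambTree n) (T' : CambTree m) :
    E 𝕜 T * E 𝕜 T' = E 𝕜 (⟨T.1.graftNE T'.1, isCambrian_graftNE T T'⟩ : CambTree (n + m)) := by
  classical
  rw [E_eq 𝕜 T, E_eq 𝕜 T']
  refine (sum_F_mul_sum_F 𝕜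
    (D'' := fun ρ => ∀ x y, (T.1.graftNE T'.1).Desc x y → ρ.symm x < ρ.symm y)
    _ _ fun σ τ ρ hρ => ?_).trans (E_eq 𝕜 (⟨_, isCambrian_graftNE T T'⟩ : CambTree _)).symm
  obtain ⟨h1, h2⟩ := mem_shiftedShuffle.1 hρ
  rw [SignedDigraph.forall_desc_graftNE]
  simp only [h1, h2]

theorem H_mul_H {n m : ℕ} (T : CambTree n) (T' : CambTree m) :
    H 𝕜 T * H 𝕜 T' = H 𝕜 (⟨T.1.graftNW T'.1, isCambrian_graftNW T T'⟩ : CambTree (n + m)) := by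
  classical
  rw [H_eq 𝕜 T, H_eq 𝕜 T']
  refine (sum_F_mul_sum_F 𝕜
    (D'' := fun ρ => ∀ x y, (T.1.graftNW T'.1).op.Desc x y → ρ.symm y < ρ.symm x)
    _ _ fun σ τ ρ hρ => ?_).trans (H_eq 𝕜 (⟨_, isCambrian_graftNW T T'⟩ : CambTree _)).symm
  obtain ⟨h1, h2⟩ := mem_shiftedShuffle.1 hρ
  simp only [SignedDigraph.graftNW_eq, SignedDigraph.op_op]
  rw [SignedDigraph.forall_desc_graftNE]
  simp only [h1, h2]

/-! ### Unitriangularity and bases -/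

/-- A family that is unitriangular over a family with a dual family. -/
theorem linearIndependent_and_span_of_unitriangular {ι M : Type*} [AddCommGroup M] [Module 𝕜 M]
    {v w : ι → M} (f : ι → M →ₗ[𝕜] 𝕜) (hf : ∀ i, f i (v i) = 1)
    (hf' : ∀ i j, i ≠ j → f i (v j) = 0) (rank : ι → ℕ)
    (hw : ∀ i, ∃ Q : Finset ι, (∀ j ∈ Q, rank j < rank i) ∧ w i = v i + ∑ j ∈ Q, v j) :
    LinearIndependent 𝕜 w ∧
      Submodule.span 𝕜 (Set.range w) = Submodule.span 𝕜 (Set.range v) := by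
  classical
  choose Q hQ hw using hw
  constructor
  · rw [linearIndependent_iff']
    intro s g hg
    by_contra hne
    push Not at hne
    obtain ⟨i₀, hi₀⟩ := hne
    -- Since the terms of `w k` other than `v k` have smaller rank than `k`, maximality makes `w i`
    -- the only vector in the relation with a nonzero coefficient that involves `v i`; so `f i`
    -- isolates `g i`.
    obtain ⟨i, hi, hmax⟩ := Finset.exists_max_image (s.filter fun i => g i ≠ 0) rank
      ⟨i₀, Finset.mem_filter.2 hi₀⟩
    rw [Finset.mem_filter] at hi
    have h0 := congrArg (f i) hg
    rw [map_zero, map_sum, Finset.sum_eq_single i] at h0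
    · rw [map_smul, hw, map_add, map_sum, hf, Finset.sum_eq_zero, add_zero, smul_eq_mul,
        mul_one] at h0
      · exact hi.2 h0
      · intro j hj
        have := hQ i j hj
        exact hf' i j (by rintro rfl; omega)
    · intro k hk hki
      by_cases hgk : g k = 0
      · simp [hgk]
      rw [map_smul, hw, map_add, map_sum, hf' i k (Ne.symm hki), Finset.sum_eq_zero, add_zero,
        smul_zero]
      intro j hj
      have h1 := hQ k j hj
      have h2 := hmax k (Finset.mem_filter.2 ⟨hk, hgk⟩)
      exact hf' i j (by rintro rfl; omega)
    · exact fun h => absurd hi.1 h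
  · apply le_antisymm
    · rw [Submodule.span_le]
      rintro _ ⟨i, rfl⟩
      rw [SetLike.mem_coe, hw]
      exact add_mem (Submodule.subset_span ⟨i, rfl⟩)
        (sum_mem fun j _ => Submodule.subset_span ⟨j, rfl⟩)
    · rw [Submodule.span_le]
      rintro _ ⟨i, rfl⟩
      induction hk : rank i using Nat.strong_induction_on generalizing i with
      | _ k ih =>
      rw [SetLike.mem_coe, eq_sub_of_add_eq (hw i).symm]
      exact sub_mem (Submodule.subset_span ⟨i, rfl⟩)
        (sum_mem fun j hj => ih _ (hk ▸ hQ i j hj) j rfl)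

-- A signed permutation occurs in `P` of at most one tree, by `IsLinearExtension.unique`.
open scoped Classical in
theorem coord_P {n m : ℕ} {T : CambTree n} {σ : Equiv.Perm (Fin n)} (hσ : T.IsLinearExtension σ)
    (S : CambTree m) : (FQSym.basis 𝕜).coord ⟨n, σ, T.1.sign⟩ (P 𝕜 S) =
      if AnyCambTree.mk n T = ⟨m, S⟩ then 1 else 0 := by
  have h1 : ∀ τ ρ, (FQSym.basis 𝕜).coord τ (F 𝕜 ρ) = if ρ = τ then 1 else 0 := by
    intro τ ρ
    rw [F, Module.Basis.coord_apply, Module.Basis.repr_self, Finsupp.single_apply]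
  rw [P, map_sum]
  simp only [h1]
  split_ifs with h
  · cases h
    rw [Finset.sum_eq_single σ]
    · simp
    · intro τ _ hτ
      rw [if_neg]
      simpa using hτ
    · simp [hσ]
  · refine Finset.sum_eq_zero fun τ hτ => if_neg fun he => h ?_
    have hτ := (Finset.mem_filter.1 hτ).2
    obtain ⟨rfl, he⟩ := SignedPerm.mk.inj he
    obtain ⟨he, hs⟩ := he
    cases he
    rw [hσ.unique hτ (eq_of_heq hs)]

/-- A sum of `P` over a principal filter or ideal. -/
theorem sum_P_unitriangular {n : ℕ} (r : CambTree n → Prop) [DecidablePred r] {T : CambTree n}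
    (hT : r T) (rank : AnyCambTree → ℕ) (h : ∀ S, r S → S ≠ T → rank ⟨n, S⟩ < rank ⟨n, T⟩) :
    ∃ Q : Finset AnyCambTree, (∀ j ∈ Q, rank j < rank ⟨n, T⟩) ∧
      ∑ S : CambTree n with r S, P 𝕜 S = P 𝕜 T + ∑ j ∈ Q, P 𝕜 j.tree := by
  classical
  refine ⟨((Finset.univ.filter r).erase T).map ⟨AnyCambTree.mk n, fun S S' h => by
    cases h; rfl⟩, fun j hj => ?_, ?_⟩
  · simp only [Finset.mem_map, Finset.mem_erase, Finset.mem_filter, Finset.mem_univ, true_and]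
      at hj
    obtain ⟨S, hS, rfl⟩ := hj
    exact h S hS.2 hS.1
  · rw [Finset.sum_map]
    exact (Finset.add_sum_erase _ _ (by simpa using hT)).symm

/-- The coefficient of a linear extension. -/
noncomputable def extensionCoord (T : AnyCambTree) : FQSym 𝕜 →ₗ[𝕜] 𝕜 :=
  (FQSym.basis 𝕜).coord
    ⟨T.size, T.tree.exists_isLinearExtension.choose, T.tree.1.sign⟩

open scoped Classical in
theorem extensionCoord_P (T S : AnyCambTree) :
    extensionCoord 𝕜 T (P 𝕜 S.tree) = if T = S then 1 else 0 :=
  coord_P 𝕜 T.tree.exists_isLinearExtension.choose_spec S.tree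

/-- The other trees in `E^T` have more decreasing relations, so the rank counts them down from the
bound `n * n`; for `H` the count itself serves. -/
theorem E_basis : LinearIndependent 𝕜 (fun T : AnyCambTree => E 𝕜 T.tree) ∧
    Submodule.span 𝕜 (Set.range fun T : AnyCambTree => E 𝕜 T.tree) = Camb 𝕜 := by
  classical
  refine linearIndependent_and_span_of_unitriangular 𝕜 (extensionCoord 𝕜)
    (fun T => by rw [extensionCoord_P, if_pos rfl])
    (fun T S h => by rw [extensionCoord_P, if_neg h])
    (fun T => T.size * T.size - T.tree.descCount) fun ⟨n, T⟩ => ?_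
  refine sum_P_unitriangular 𝕜 (fun S => T.Le S) (.refl T) _ fun S hS hne => ?_
  have h1 := hS.eq_or_descCount_lt.resolve_left (Ne.symm hne)
  have h2 := S.descCount_le
  show n * n - S.descCount < n * n - T.descCount
  omega

theorem H_basis : LinearIndependent 𝕜 (fun T : AnyCambTree => H 𝕜 T.tree) ∧
    Submodule.span 𝕜 (Set.range fun T : AnyCambTree => H 𝕜 T.tree) = Camb 𝕜 := by
  classical
  refine linearIndependent_and_span_of_unitriangular 𝕜 (extensionCoord 𝕜)
    (fun T => by rw [extensionCoord_P, if_pos rfl])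
    (fun T S h => by rw [extensionCoord_P, if_neg h])
    (fun T => T.tree.descCount) fun ⟨n, T⟩ => ?_
  exact sum_P_unitriangular 𝕜 (fun S => S.Le T) (.refl T) _ fun S hS hne =>
    hS.eq_or_descCount_lt.resolve_left hne

end Algebra

end Cambrian

theorem mainTheorem5 (𝕜 : Type*) [Field 𝕜] :
    (LinearIndependent 𝕜 (fun T : Cambrian.AnyCambTree => Cambrian.E 𝕜 T.tree) ∧
      Submodule.span 𝕜 (Set.range fun T : Cambrian.AnyCambTree => Cambrian.E 𝕜 T.tree) =
        Cambrian.Camb 𝕜 ∧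
      ∀ (n m : ℕ) (T : Cambrian.CambTree n) (T' : Cambrian.CambTree m),
        ∃ h : (T.1.graftNE T'.1).IsCambrian,
          Cambrian.E 𝕜 T * Cambrian.E 𝕜 T' =
            Cambrian.E 𝕜 (⟨T.1.graftNE T'.1, h⟩ : Cambrian.CambTree (n + m))) ∧
    (LinearIndependent 𝕜 (fun T : Cambrian.AnyCambTree => Cambrian.H 𝕜 T.tree) ∧
      Submodule.span 𝕜 (Set.range fun T : Cambrian.AnyCambTree => Cambrian.H 𝕜 T.tree) =
        Cambrian.Camb 𝕜 ∧
      ∀ (n m : ℕ) (T : Cambrian.CambTree n) (T' : Cambrian.CambTree m),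
        ∃ h : (T.1.graftNW T'.1).IsCambrian,
          Cambrian.H 𝕜 T * Cambrian.H 𝕜 T' =
            Cambrian.H 𝕜 (⟨T.1.graftNW T'.1, h⟩ : Cambrian.CambTree (n + m))) :=
  ⟨⟨(Cambrian.E_basis 𝕜).1, (Cambrian.E_basis 𝕜).2, fun _ _ T T' =>
      ⟨Cambrian.isCambrian_graftNE T T', Cambrian.E_mul_E 𝕜 T T'⟩⟩,
    (Cambrian.H_basis 𝕜).1, (Cambrian.H_basis 𝕜).2, fun _ _ T T' =>
      ⟨Cambrian.isCambrian_graftNW T T', Cambrian.H_mul_H 𝕜 T T'⟩⟩
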